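/- **Setting.** For each $N$, let $(R,Y,\mathbf X)\in\{0,1\}\times\mathbb R\times\mathbb R^{p}$, $p=p_N$, have a law depending on $N$, with $Y$ integrable, $\pi_N:=\mathbb P(R=1)>0$, $\overrightarrow{\mathbf X}:=(1,\mathbf X^T)^T\in\mathbb R^{p+1}$, and propensity score $$\pi_N(\mathbf X):=\mathbb E(R\mid\mathbf X)=\frac{\pi_N\exp(\overrightarrow{\mathbf X}^T\gamma_0)}{1+\pi_N\exp(\overrightarrow{\mathbf X}^T\gamma_0)},\qquad \gamma_0=\gamma_{0,N}\in\mathbb R^{p+1}.$$ Let $m(\mathbf x):=\mathbb E(Y\mid\mathbf X=\mathbf x)$, $a_N:=[\mathbb E\{\pi_N^{-1}(\mathbf X)\}]^{-1}$, $S:=\{j:\gamma_0(j)\ne0\}$, $s:=|S|$. From i.i.d. copies $(R_i,Y_i,\mathbf X_i)_{i\le N}$ put $\widehat\pi_N:=N^{-1}\sum_iR_i$, $$\ell_N(\gamma;a):=-N^{-1}\sum_{i=1}^N\big[R_i\overrightarrow{\mathbf X}_i^T\gamma-\log\{1+a\exp(\overrightarrow{\mathbf X}_i^T\gamma)\}\big],\qquad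 \widehat\gamma\in\arg\min_{\gamma\in\mathbb R^{p+1}}\{\ell_N(\gamma;\widehat\pi_N)+\lambda_N\|\gamma\|_1\},$$ $\widehat\pi_N(\mathbf x):=\widehat\pi_N\exp(\overrightarrow{\mathbf x}^T\widehat\gamma)/\{1+\widehat\pi_N\exp(\overrightarrow{\mathbf x}^T\widehat\gamma)\}$, and $\delta\ell(\Delta;a;\gamma):=\ell_N(\gamma+\Delta;a)-\ell_N(\gamma;a)-\Delta^T\nabla_\gamma\ell_N(\gamma;a)$. Write $\|W\|_{\psi_2}:=\inf\{t>0:\mathbb E\exp(W^2/t^2)\le2\}$, $\|f\|_{r,\mathbb P_{\mathbf X}}:=\{\mathbb E_{\mathbf X}|f(\mathbf X)|^r\}^{1/r}$ where $\mathbb E_{\mathbf X}$ integrates over an independent copy of $\mathbf X$ only, and $u_N\asymp v_N$ if $cv_N<u_N<Cv_N$ for all large $N$ with constants $c,C>0$. **Theorem.** Let $\sigma,\sigma_{\gamma_0}>0$ be constants with $\|\overrightarrow{\mathbf X}^T\gamma_0\|_{\psi_2}\le\sigma_{\gamma_0}$ and $\max_{j\le p+1}\|\overrightarrow{\mathbf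 X}(j)\|_{\psi_2}\le\sigma$ for all $N$. Let $\kappa>0$ be a constant such that, with probability at least $1-\alpha_N$, $\delta\ell(\Delta;1;\gamma_0)\ge\kappa\|\Delta\|_2^2$ for all $\Delta$ with $\|\Delta_{S^c}\|_1\le3\|\Delta_S\|_1$ and $\|\Delta\|_2\le1$. (i) There are constants $C_5,C_6>0$ depending only on $\sigma,\sigma_{\gamma_0}$ such that, with $$M_N:=C_5\sqrt{\frac{\pi_N\log(p+1)}{N}}+C_6\frac{\sqrt{\log(2N)}\log(p+1)}{N},$$ for every $N$, every $c>0$ with $N\pi_N>9c\log(p+1)$ and every $\lambda_N$ with $2(1+c)M_N\le\lambda_N\le\frac19\kappa\pi_Ns^{-1/2}$, every minimizer $\widehat\gamma$ satisfies $$\|\widehat\gamma-\gamma_0\|_2\le9\,\lambda_Ns^{1/2}\pi_N^{-1}\kappa^{-1}\quad\text{with probability at least }1-8(p+1)^{-c}-\alpha_N .$$ (ii) Assume in addition that, as $N\to\infty$, $p\to\infty$, $\alpha_N\to0$, $\log(p)\log(N)=O(N\pi_N)$, $s\log(p)=o(N\pi_N)$, and that $\|\overrightarrow{\mathbf X}^T\mathbf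 v\|_{\psi_2}\le\sigma\|\mathbf v\|_2$ for all $\mathbf v\in\mathbb R^{p+1}$. Then $\|\pi_N^{-1}(\mathbf X)\|_{r,\mathbb P_{\mathbf X}}\asymp\pi_N^{-1}$ for every $r>0$, and $a_N\asymp\pi_N$. For every $c>0$ there is a sequence $\lambda_N\asymp\sqrt{\pi_N\log(p)/N}$, which for all large $N$ meets the conditions of (i), such that, for any choice of minimizers, $$\Big\|1-\frac{\pi_N(\cdot)}{\widehat\pi_N(\cdot)}\Big\|_{r,\mathbb P_{\mathbf X}}=O_p\Big(\sqrt{\frac{s\log p}{N\pi_N}}\Big)\quad\forall r>0,\qquad \mathbb E_{\mathbf X}\Big[\frac{a_N}{\pi_N(\mathbf X)}\Big\{1-\frac{\pi_N(\mathbf X)}{\widehat\pi_N(\mathbf X)}\Big\}^2\Big]=O_p\Big(\frac{s\log p}{N\pi_N}\Big)=o_p(1).$$ Moreover, for any random functions $\widehat m$ with $\|\widehat m-m\|_{2+c_2,\mathbb P_{\mathbf X}}=o_p(1)$ for a constant $c_2>0$, $$\mathbb E_{\mathbf X}\Big[\frac{a_N}{\pi_N(\mathbf X)}\{\widehat m(\mathbf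 X)-m(\mathbf X)\}^2\Big]=o_p(1).$$ -/

import Mathlib

open MeasureTheory ProbabilityTheory Filter Topology Asymptotics
open scoped ENNReal

noncomputable section

namespace OffsetLogit

/-- `ℝⁿ` with the Euclidean norm `‖·‖₂`. -/
abbrev Vec (n : ℕ) : Type := EuclideanSpace ℝ (Fin n)

/-- One unit `(R, Y, X)`: label indicator, outcome, covariate vector. -/
abbrev Obs (p : ℕ) : Type := ℝ × ℝ × Vec p

/-- The covariate vector with an intercept coordinate, `(1, xᵀ)ᵀ ∈ ℝ^{p+1}`. -/
def augment {p : ℕ} (x : Vec p) : Vec (p + 1) :=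
  WithLp.toLp 2 (Fin.cons 1 (fun j => x j))

/-- The linear predictor `(1, xᵀ) γ`. -/
def linPred {p : ℕ} (γ : Vec (p + 1)) (x : Vec p) : ℝ :=
  inner ℝ (augment x) γ

/-- The offset logistic propensity score with offset `log a`. -/
def offsetPS {p : ℕ} (a : ℝ) (γ : Vec (p + 1)) (x : Vec p) : ℝ :=
  a * Real.exp (linPred γ x) / (1 + a * Real.exp (linPred γ x))

/-! ### Population -/

/-- `ℙ(R = 1)`. -/
def labelProb {p : ℕ} (Q : Measure (Obs p)) : ℝ := Q.real {z | z.1 = 1}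

/-- The marginal law of the covariates. -/
def covLaw {p : ℕ} (Q : Measure (Obs p)) : Measure (Vec p) := Q.map (fun z => z.2.2)

/-- The σ-algebra generated by the covariates. -/
abbrev covSigma (p : ℕ) : MeasurableSpace (Obs p) :=
  MeasurableSpace.comap (fun z => z.2.2) inferInstance

/-- `Q` is a law of `(R, Y, X)` with `R ∈ {0, 1}`, `ℙ(R = 1) > 0`, `Y` integrable, whose propensity
score `𝔼(R | X)` is the offset logistic one with parameter `γ₀` and offset `log ℙ(R = 1)`. -/
structure IsOffsetModel {p : ℕ} (Q : Measure (Obs p)) (γ₀ : Vec (p + 1)) : Prop where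
  prob : IsProbabilityMeasure Q
  binary : ∀ᵐ z ∂Q, z.1 = 0 ∨ z.1 = 1
  labelProb_pos : 0 < labelProb Q
  integrable_outcome : Integrable (fun z : Obs p => z.2.1) Q
  propensity : Q[fun z : Obs p => z.1 | covSigma p]
    =ᵐ[Q] fun z => offsetPS (labelProb Q) γ₀ z.2.2

/-- `m` is (a version of) the regression function `m(x) = 𝔼(Y | X = x)`. -/
def IsRegression {p : ℕ} (Q : Measure (Obs p)) (m : Vec p → ℝ) : Prop :=
  Measurable m ∧ Q[fun z : Obs p => z.2.1 | covSigma p] =ᵐ[Q] fun z => m z.2.2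

/-- The true propensity score `π_N(x)` under the offset model. -/
def truePS {p : ℕ} (Q : Measure (Obs p)) (γ₀ : Vec (p + 1)) : Vec p → ℝ :=
  offsetPS (labelProb Q) γ₀

/-- `a_N`, given by `a_N⁻¹ = 𝔼{π_N⁻¹(X)}`. -/
def effRate {p : ℕ} (Q : Measure (Obs p)) (γ₀ : Vec (p + 1)) : ℝ :=
  (∫ x, (truePS Q γ₀ x)⁻¹ ∂(covLaw Q))⁻¹

/-- The `ψ₂` (Orlicz) norm `inf {t > 0 : 𝔼 exp(W² / t²) ≤ 2}`, equal to `∞` if there is no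
such `t`. -/
def psi2Norm {α : Type*} [MeasurableSpace α] (μ : Measure α) (W : α → ℝ) : ℝ≥0∞ :=
  ⨅ (t : ℝ) (_ : 0 < t ∧ ∫⁻ x, ENNReal.ofReal (Real.exp (W x ^ 2 / t ^ 2)) ∂μ ≤ 2),
    ENNReal.ofReal t

/-! ### Sample, loss and estimator -/

/-- `Z₁, …, Z_N` are i.i.d. with law `Q`. -/
def IsIIDSample {Ω : Type*} [MeasurableSpace Ω] {p N : ℕ} (P : Measure Ω)
    (Z : Fin N → Ω → Obs p) (Q : Measure (Obs p)) : Prop :=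
  (∀ i, Measurable (Z i)) ∧ iIndepFun Z P ∧ ∀ i, P.map (Z i) = Q

/-- `π̂_N = N⁻¹ ∑ Rᵢ`. -/
def labelFreq {p N : ℕ} (z : Fin N → Obs p) : ℝ := (N : ℝ)⁻¹ * ∑ i, (z i).1

/-- The offset logistic loss
`ℓ_N(γ; a) = -N⁻¹ ∑ [Rᵢ Xᵢᵀγ - log{1 + a exp(Xᵢᵀγ)}]` (with intercept). -/
def loss {p N : ℕ} (z : Fin N → Obs p) (a : ℝ) (γ : Vec (p + 1)) : ℝ :=
  -((N : ℝ)⁻¹ * ∑ i, ((z i).1 * linPred γ (z i).2.2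
    - Real.log (1 + a * Real.exp (linPred γ (z i).2.2))))

/-- `δℓ(Δ; a; γ) = ℓ_N(γ + Δ; a) - ℓ_N(γ; a) - Δᵀ ∇ℓ_N(γ; a)`. -/
def excessLoss {p N : ℕ} (z : Fin N → Obs p) (Δ : Vec (p + 1)) (a : ℝ) (γ : Vec (p + 1)) : ℝ :=
  loss z a (γ + Δ) - loss z a γ - inner ℝ Δ (gradient (loss z a) γ)

/-- Restricted strong convexity of `δℓ(·; a; γ₀)` with parameter `κ` on the set `A`. -/
def RSC {p N : ℕ} (z : Fin N → Obs p) (a : ℝ) (γ₀ : Vec (p + 1)) (κ : ℝ)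
    (A : Set (Vec (p + 1))) : Prop :=
  ∀ Δ ∈ A, κ * ‖Δ‖ ^ 2 ≤ excessLoss z Δ a γ₀

/-- The support `S` of a vector. -/
def support {n : ℕ} (γ : Vec n) : Finset (Fin n) := Finset.univ.filter (fun j => γ j ≠ 0)

/-- The sparsity level `s = ‖γ‖₀`. -/
def sparsity {n : ℕ} (γ : Vec n) : ℕ := (support γ).card

/-- `{Δ : ‖Δ_{Sᶜ}‖₁ ≤ 3 ‖Δ_S‖₁, ‖Δ‖₂ ≤ 1}`. -/
def coneBall {n : ℕ} (S : Finset (Fin n)) : Set (Vec n) :=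
  {Δ | ∑ j ∈ Sᶜ, |Δ j| ≤ 3 * ∑ j ∈ S, |Δ j| ∧ ‖Δ‖ ≤ 1}

/-- `γ̂` is a solution of `argmin_γ {ℓ_N(γ; π̂_N) + lam ‖γ‖₁}`. -/
def IsL1Estimator {p N : ℕ} (z : Fin N → Obs p) (lam : ℝ) (γhat : Vec (p + 1)) : Prop :=
  ∀ γ : Vec (p + 1),
    loss z (labelFreq z) γhat + lam * ∑ j, |γhat j| ≤ loss z (labelFreq z) γ + lam * ∑ j, |γ j|

/-- The estimated propensity score `π̂_N(x)`. -/
def estPS {p N : ℕ} (z : Fin N → Obs p) (γhat : Vec (p + 1)) : Vec p → ℝ :=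
  offsetPS (labelFreq z) γhat

/-- `M_N = C₅ √(π log(p+1)/N) + C₆ √(log(2N)) log(p+1)/N`. -/
def gradBound (C₅ C₆ π : ℝ) (N p : ℕ) : ℝ :=
  C₅ * √(π * Real.log (p + 1) / N)
    + C₆ * (√(Real.log (2 * N)) * Real.log (p + 1) / N)

/-- `𝔼_X[(a_N / π_N(X)) h(X)²]`, the expectation being over `X` only. -/
def weightedMSE {p : ℕ} (Q : Measure (Obs p)) (γ₀ : Vec (p + 1)) (h : Vec p → ℝ) : ℝ≥0∞ :=
  ∫⁻ x, ENNReal.ofReal (effRate Q γ₀ / truePS Q γ₀ x * h x ^ 2) ∂(covLaw Q)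

/-! ### Asymptotic notation -/

/-- `a_N ≍ b_N`. -/
def SameOrder (a b : ℕ → ℝ) : Prop :=
  ∃ c > 0, ∃ C > 0, ∃ N₀ : ℕ, ∀ N > N₀, c * b N < a N ∧ a N < C * b N

variable {Ω : ℕ → Type*} [∀ N, MeasurableSpace (Ω N)]

/-- `W_N = O_p(r_N)` for `[0, ∞]`-valued `W_N`. (The bound is on the outer measure, so that
nothing is lost if `W_N` is not known to be measurable.) -/
def IsBigOP (P : ∀ N, Measure (Ω N)) (W : ∀ N, Ω N → ℝ≥0∞) (r : ℕ → ℝ) : Prop :=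
  ∀ ε : ℝ, 0 < ε → ∃ M : ℝ, 0 < M ∧ ∃ N₀ : ℕ, ∀ N ≥ N₀,
    P N {ω | ENNReal.ofReal (M * r N) < W N ω} ≤ ENNReal.ofReal ε

/-- `W_N = o_p(1)` for `[0, ∞]`-valued `W_N`. -/
def IsLittleOPOne (P : ∀ N, Measure (Ω N)) (W : ∀ N, Ω N → ℝ≥0∞) : Prop :=
  ∀ ε : ℝ, 0 < ε → Tendsto (fun N => P N {ω | ENNReal.ofReal ε < W N ω}) atTop (𝓝 0)

end OffsetLogit

end

open OffsetLogit

/-! The excess loss is an average of Bregman divergences of `u ↦ log (1 + a eᵘ)`. For `0 ≤ a ≤ 1`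
the divergence with offset `a` is at least `a` times the one with offset `1` (`mul_bregman_one_le`),
so restricted strong convexity of the balanced loss with parameter `κ` passes to the loss with
offset `π̂` with parameter `π̂ κ ≥ π κ / 2`. With this curvature, the usual cone argument for an
`ℓ₁` penalty (`norm_sub_le_of_isL1Estimator`) bounds every minimizer as soon as the penalty is at
least twice each coordinate of the score at `γ₀`.

The score must be small at the scale of the rare label, with variance of order `π / N`. At the true
offset it is an average of centred terms `(R - π(X)) X_j`, and `(R - π(X))² ≤ R + π(X)` together
with `π(X) ≤ π exp(Xᵀγ₀)` gives exponentially weighted second moments of order `π`; a Bernstein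
bound applies (`measure_abs_score_ge_le`). Replacing `π` by `π̂` costs the relative error `|π̂ - π|
/ π` times an average of `π(X) |X_j|`, which is again of order `π` (`abs_score_le`,
`measure_average_link_mul_abs_ge_le`). A union bound over coordinates yields `exists_good_event`.

For the asymptotics, `1 / π(X) = 1 + π⁻¹ exp(-Xᵀγ₀)` is explicit, so sub-Gaussianity of `Xᵀγ₀`
controls all its moments from both sides. The ratio of true to estimated propensity differs from `1`
by at most a multiple of `(|π̂ - π| / π + ‖γ̂ - γ₀‖) exp(2 |Xᵀv|)` with `v` a unit vector, when `‖γ̂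
- γ₀‖ ≤ 1` and `π̂ ≥ π / 2` (`abs_one_sub_link_div_le`). Since `a_N / π_N(X)` has bounded moments of
every order, Hölder's inequality turns `L^r` rates with `r > 2` into weighted mean squared rates
(`weightedMSE_le`). -/

namespace OffsetLogit

/-! ### The offset logistic link and its Bregman divergence -/

/-- The offset logistic link `a eᵘ / (1 + a eᵘ)`. -/
noncomputable def link (a u : ℝ) : ℝ := a * Real.exp u / (1 + a * Real.exp u)

/-- The Bregman divergence of `u ↦ log (1 + a eᵘ)`. -/
noncomputable def bregman (a u v : ℝ) : ℝ :=
  Real.log (1 + a * Real.exp (u + v)) - Real.log (1 + a * Real.exp u) - v * link a u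

theorem one_add_mul_exp_pos {a : ℝ} (ha : 0 ≤ a) (u : ℝ) : 0 < 1 + a * Real.exp u := by
  positivity

theorem link_nonneg {a : ℝ} (ha : 0 ≤ a) (u : ℝ) : 0 ≤ link a u := by
  unfold link; positivity

theorem link_le_one {a : ℝ} (ha : 0 ≤ a) (u : ℝ) : link a u ≤ 1 := by
  unfold link
  rw [div_le_one (one_add_mul_exp_pos ha u)]
  linarith

theorem link_le_mul_exp {a : ℝ} (ha : 0 ≤ a) (u : ℝ) : link a u ≤ a * Real.exp u := by
  unfold link
  have : 0 ≤ a * Real.exp u := by positivity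
  exact div_le_self this (by linarith)

theorem inv_link {a : ℝ} (ha : 0 < a) (u : ℝ) :
    (link a u)⁻¹ = 1 + a⁻¹ * Real.exp (-u) := by
  unfold link
  have := Real.exp_pos u
  rw [Real.exp_neg]
  field_simp
  ring

/-- The error is measured relative to `link a u`, which is itself of order `a`; this preserves the
factor `π` when the offset is estimated. -/
theorem abs_link_sub_link_le {a b : ℝ} (ha : 0 < a) (hb : 0 ≤ b) (u : ℝ) :
    |link a u - link b u| ≤ |b - a| / a * link a u := by
  have h1 := one_add_mul_exp_pos ha.le u
  have h2 := one_add_mul_exp_pos hb u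
  have h3 : link a u - link b u = (a - b) / a * link a u * (1 / (1 + b * Real.exp u)) := by
    unfold link
    field_simp
    ring
  have h4 : 1 / (1 + b * Real.exp u) ≤ 1 := by
    rw [div_le_one h2]
    have : 0 ≤ b * Real.exp u := by positivity
    linarith
  rw [h3, abs_mul, abs_mul, abs_div, abs_of_pos ha, abs_of_nonneg (link_nonneg ha.le u),
    abs_of_pos (one_div_pos.2 h2), abs_sub_comm]
  exact mul_le_of_le_one_right
    (mul_nonneg (by positivity) (link_nonneg ha.le u)) h4

theorem hasDerivAt_log_one_add_mul_exp {a : ℝ} (ha : 0 ≤ a) (u : ℝ) :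
    HasDerivAt (fun u => Real.log (1 + a * Real.exp u)) (link a u) u :=
  (((Real.hasDerivAt_exp u).const_mul a).const_add 1).log (one_add_mul_exp_pos ha u).ne'

/-- The difference factors as `a (1 - a)` times a product of two nonnegative increasing functions of
`eʷ`. It is the derivative of the function whose convexity compares the two Bregman divergences. -/
theorem monotone_link_sub {a : ℝ} (ha : 0 ≤ a) (ha1 : a ≤ 1) :
    Monotone (fun u => link a u - a * link 1 u) := by
  intro u v huv
  have hlin : ∀ b : ℝ, 0 ≤ b → Real.exp u / (1 + b * Real.exp u)
      ≤ Real.exp v / (1 + b * Real.exp v) := by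
    intro b hb
    rw [div_le_div_iff₀ (one_add_mul_exp_pos hb u) (one_add_mul_exp_pos hb v)]
    nlinarith [Real.exp_le_exp.2 huv]
  have key : ∀ w, link a w - a * link 1 w
      = a * (1 - a) * (Real.exp w / (1 + a * Real.exp w) * (Real.exp w / (1 + 1 * Real.exp w))) := by
    intro w
    have h1 := one_add_mul_exp_pos ha w
    have h2 := one_add_mul_exp_pos zero_le_one w
    unfold link
    field_simp
    ring
  simp only [key]
  refine mul_le_mul_of_nonneg_left ?_ (mul_nonneg ha (by linarith))
  exact mul_le_mul (hlin a ha) (hlin 1 zero_le_one)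
    (by positivity) (by positivity)

theorem monotone_link {a : ℝ} (ha : 0 ≤ a) : Monotone (link a) := by
  intro u v huv
  unfold link
  rw [div_le_div_iff₀ (one_add_mul_exp_pos ha u) (one_add_mul_exp_pos ha v)]
  nlinarith [mul_le_mul_of_nonneg_left (Real.exp_le_exp.2 huv) ha]

/-- A function with monotone derivative is convex and lies above its tangents. Used both for
nonnegativity of the divergence and for comparing two offsets. -/
theorem le_of_hasDerivAt_of_monotone {f f' : ℝ → ℝ} (hf : ∀ x, HasDerivAt f (f' x) x)
    (hmono : Monotone f') (u v : ℝ) : v * f' u ≤ f (u + v) - f u := by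
  have hc : ConvexOn ℝ Set.univ f := by
    refine Monotone.convexOn_univ_of_deriv (fun x => (hf x).differentiableAt) ?_
    have : deriv f = f' := funext fun x => (hf x).deriv
    rwa [this]
  rcases lt_trichotomy v 0 with hv | rfl | hv
  · have h := hc.slope_le_of_hasDerivAt (Set.mem_univ (u + v)) (Set.mem_univ u) (by linarith) (hf u)
    rw [slope_def_field, div_le_iff₀ (by linarith)] at h
    nlinarith
  · simp
  · have h := hc.le_slope_of_hasDerivAt (Set.mem_univ u) (Set.mem_univ (u + v)) (by linarith) (hf u)
    rw [slope_def_field, le_div_iff₀ (by linarith)] at h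
    nlinarith

theorem mul_bregman_one_le {a : ℝ} (ha : 0 ≤ a) (ha1 : a ≤ 1) (u v : ℝ) :
    a * bregman 1 u v ≤ bregman a u v := by
  have h := le_of_hasDerivAt_of_monotone
    (fun x => (hasDerivAt_log_one_add_mul_exp ha x).sub
      ((hasDerivAt_log_one_add_mul_exp zero_le_one x).const_mul a))
    (monotone_link_sub ha ha1) u v
  simp only [Pi.sub_apply] at h
  unfold bregman
  linarith

theorem bregman_nonneg {a : ℝ} (ha : 0 ≤ a) (u v : ℝ) : 0 ≤ bregman a u v := by
  have h := le_of_hasDerivAt_of_monotone (hasDerivAt_log_one_add_mul_exp ha) (monotone_link ha) u v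
  unfold bregman
  linarith

/-- Convexity along the segment from `u` to `u + v`. It lets strong convexity on the unit ball be
exploited for longer increments. -/
theorem bregman_mul_le {a t : ℝ} (ha : 0 ≤ a) (ht : 0 ≤ t) (ht1 : t ≤ 1) (u v : ℝ) :
    bregman a u (t * v) ≤ t * bregman a u v := by
  have hc : ConvexOn ℝ Set.univ (fun u => Real.log (1 + a * Real.exp u)) := by
    refine Monotone.convexOn_univ_of_deriv
      (fun x => (hasDerivAt_log_one_add_mul_exp ha x).differentiableAt) ?_
    have : deriv (fun u => Real.log (1 + a * Real.exp u)) = link a :=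
      funext fun x => (hasDerivAt_log_one_add_mul_exp ha x).deriv
    rw [this]
    exact monotone_link ha
  have h := hc.2 (Set.mem_univ u) (Set.mem_univ (u + v)) (sub_nonneg.2 ht1) ht (by ring)
  simp only [smul_eq_mul] at h
  rw [show (1 - t) * u + t * (u + v) = u + t * v by ring] at h
  unfold bregman
  linarith

/-! ### The loss -/

section Loss

variable {p N : ℕ}

theorem linPred_add (γ Δ : Vec (p + 1)) (x : Vec p) :
    linPred (γ + Δ) x = linPred γ x + linPred Δ x := inner_add_right _ _ _

theorem linPred_smul (t : ℝ) (Δ : Vec (p + 1)) (x : Vec p) :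
    linPred (t • Δ) x = t * linPred Δ x := inner_smul_right _ _ _

theorem linPred_eq_sum (Δ : Vec (p + 1)) (x : Vec p) :
    linPred Δ x = ∑ j, Δ j * augment x j := by
  simp [linPred, PiLp.inner_apply]

theorem offsetPS_eq_link (a : ℝ) (γ : Vec (p + 1)) (x : Vec p) :
    offsetPS a γ x = link a (linPred γ x) := rfl

/-- The negative partial derivative of the loss in direction `j`. -/
noncomputable def score (z : Fin N → Obs p) (a : ℝ) (γ : Vec (p + 1)) (j : Fin (p + 1)) : ℝ :=
  (N : ℝ)⁻¹ * ∑ i, ((z i).1 - link a (linPred γ (z i).2.2)) * augment (z i).2.2 j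

theorem sum_mul_score (z : Fin N → Obs p) (a : ℝ) (γ Δ : Vec (p + 1)) :
    ∑ j, Δ j * score z a γ j
      = (N : ℝ)⁻¹ * ∑ i, ((z i).1 - link a (linPred γ (z i).2.2)) * linPred Δ (z i).2.2 := by
  simp only [score, linPred_eq_sum Δ, Finset.mul_sum]
  rw [Finset.sum_comm]
  refine Finset.sum_congr rfl fun i _ => Finset.sum_congr rfl fun j _ => ?_
  ring

theorem loss_add_sub (z : Fin N → Obs p) (a : ℝ) (γ Δ : Vec (p + 1)) :
    loss z a (γ + Δ) - loss z a γ
      = (N : ℝ)⁻¹ * ∑ i, bregman a (linPred γ (z i).2.2) (linPred Δ (z i).2.2)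
        - ∑ j, Δ j * score z a γ j := by
  rw [sum_mul_score]
  simp only [loss, linPred_add, bregman]
  rw [neg_sub_neg, ← mul_sub, ← mul_sub, ← Finset.sum_sub_distrib, ← Finset.sum_sub_distrib]
  congr 1
  refine Finset.sum_congr rfl fun i _ => ?_
  ring

theorem inner_gradient_loss (z : Fin N → Obs p) {a : ℝ} (ha : 0 ≤ a) (γ Δ : Vec (p + 1)) :
    inner ℝ Δ (gradient (loss z a) γ) = - ∑ j, Δ j * score z a γ j := by
  have hlin : ∀ x : Vec p, HasFDerivAt (fun γ : Vec (p + 1) => linPred γ x)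
      (innerSL ℝ (augment x)) γ := fun x => (innerSL ℝ (augment x)).hasFDerivAt
  have h : HasFDerivAt (loss z a) (-((N : ℝ)⁻¹ • ∑ i, ((z i).1 • innerSL ℝ (augment (z i).2.2)
      - link a (linPred γ (z i).2.2) • innerSL ℝ (augment (z i).2.2)))) γ := by
    refine HasFDerivAt.neg (HasFDerivAt.const_mul (HasFDerivAt.fun_sum fun i _ => ?_) _)
    refine ((hlin _).const_mul _).sub ?_
    exact (hasDerivAt_log_one_add_mul_exp ha _).comp_hasFDerivAt γ (hlin _)
  have h2 : inner ℝ (gradient (loss z a) γ) Δ = fderiv ℝ (loss z a) γ Δ := by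
    rw [← InnerProductSpace.toDual_apply_apply (𝕜 := ℝ), toDual_gradient]
  rw [real_inner_comm, h2, h.fderiv, sum_mul_score]
  simp only [neg_apply, smul_apply,
    sum_apply, sub_apply, innerSL_apply_apply, smul_eq_mul,
    linPred, sub_mul]

theorem excessLoss_eq (z : Fin N → Obs p) {a : ℝ} (ha : 0 ≤ a) (γ Δ : Vec (p + 1)) :
    excessLoss z Δ a γ
      = (N : ℝ)⁻¹ * ∑ i, bregman a (linPred γ (z i).2.2) (linPred Δ (z i).2.2) := by
  rw [excessLoss, inner_gradient_loss z ha, loss_add_sub]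
  ring

theorem excessLoss_smul_le (z : Fin N → Obs p) {t : ℝ} (ht : 0 ≤ t) (ht1 : t ≤ 1)
    (γ Δ : Vec (p + 1)) : excessLoss z (t • Δ) 1 γ ≤ t * excessLoss z Δ 1 γ := by
  rw [excessLoss_eq z (zero_le_one' ℝ), excessLoss_eq z (zero_le_one' ℝ), mul_left_comm,
    Finset.mul_sum _ _ t]
  refine mul_le_mul_of_nonneg_left (Finset.sum_le_sum fun i _ => ?_) (by positivity)
  rw [linPred_smul]
  exact bregman_mul_le zero_le_one ht ht1 _ _

theorem mul_excessLoss_one_le (z : Fin N → Obs p) {a : ℝ} (ha : 0 ≤ a) (ha1 : a ≤ 1)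
    (γ Δ : Vec (p + 1)) : a * excessLoss z Δ 1 γ ≤ excessLoss z Δ a γ := by
  rw [excessLoss_eq z (zero_le_one' ℝ), excessLoss_eq z ha, mul_left_comm,
    Finset.mul_sum _ _ a]
  exact mul_le_mul_of_nonneg_left (Finset.sum_le_sum fun i _ => mul_bregman_one_le ha ha1 _ _)
    (by positivity)

theorem excessLoss_nonneg (z : Fin N → Obs p) {a : ℝ} (ha : 0 ≤ a)
    (γ Δ : Vec (p + 1)) : 0 ≤ excessLoss z Δ a γ := by
  rw [excessLoss_eq z ha]
  exact mul_nonneg (by positivity) (Finset.sum_nonneg fun i _ => bregman_nonneg ha _ _)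

/-! ### Deterministic bound for the `ℓ₁`-penalized estimator -/

theorem sum_support_abs_le (S : Finset (Fin (p + 1))) (Δ : Vec (p + 1)) :
    ∑ j ∈ S, |Δ j| ≤ √(S.card) * ‖Δ‖ := by
  have h := Finset.sum_mul_sq_le_sq_mul_sq S (fun _ => (1 : ℝ)) (fun j => |Δ j|)
  simp only [one_mul, one_pow, Finset.sum_const, nsmul_eq_mul, mul_one, sq_abs] at h
  have h2 : ∑ j ∈ S, Δ j ^ 2 ≤ ‖Δ‖ ^ 2 := by
    rw [EuclideanSpace.norm_sq_eq]
    simp only [Real.norm_eq_abs, sq_abs]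
    exact Finset.sum_le_sum_of_subset_of_nonneg (Finset.subset_univ S) fun _ _ _ => sq_nonneg _
  refine abs_le_of_sq_le_sq' ?_ (by positivity) |>.2
  rw [mul_pow, Real.sq_sqrt (Nat.cast_nonneg _)]
  exact h.trans (mul_le_mul_of_nonneg_left h2 (Nat.cast_nonneg _))

/-- The basic inequality: compare the penalized loss at `γhat` and at `γ₀`, absorb the linear term
into half of the penalty, and use that `γ₀` vanishes off its support. -/
theorem excessLoss_le_of_isL1Estimator {z : Fin N → Obs p} {lam : ℝ} {γ₀ γhat : Vec (p + 1)}
    (ha : 0 ≤ labelFreq z)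
    (hscore : ∀ j, |score z (labelFreq z) γ₀ j| ≤ lam / 2) (hγ : IsL1Estimator z lam γhat) :
    excessLoss z (γhat - γ₀) (labelFreq z) γ₀
      ≤ 3 / 2 * lam * ∑ j ∈ support γ₀, |(γhat - γ₀) j|
        - lam / 2 * ∑ j ∈ (support γ₀)ᶜ, |(γhat - γ₀) j| := by
  set Δ := γhat - γ₀ with hΔ
  have hlam : 0 ≤ lam := by
    have := (abs_nonneg _).trans (hscore 0)
    linarith
  have hmin := hγ γ₀
  have hgh : γhat = γ₀ + Δ := by rw [hΔ]; abel
  have hloss := loss_add_sub z (labelFreq z) γ₀ Δ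
  rw [← excessLoss_eq z ha] at hloss
  have hsc : ∑ j, Δ j * score z (labelFreq z) γ₀ j ≤ lam / 2 * ∑ j, |Δ j| := by
    rw [Finset.mul_sum]
    refine Finset.sum_le_sum fun j _ => (le_abs_self _).trans ?_
    rw [abs_mul, mul_comm]
    exact mul_le_mul_of_nonneg_right (hscore j) (abs_nonneg _)
  have hpen : ∑ j, |γ₀ j| - ∑ j, |γhat j|
      ≤ ∑ j ∈ support γ₀, |Δ j| - ∑ j ∈ (support γ₀)ᶜ, |Δ j| := by
    rw [← Finset.sum_add_sum_compl (support γ₀) (fun j => |γ₀ j|),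
      ← Finset.sum_add_sum_compl (support γ₀) (fun j => |γhat j|)]
    have h1 : ∑ j ∈ (support γ₀)ᶜ, |γ₀ j| = 0 := by
      refine Finset.sum_eq_zero fun j hj => ?_
      simpa [support] using hj
    have h2 : ∑ j ∈ (support γ₀)ᶜ, |γhat j| = ∑ j ∈ (support γ₀)ᶜ, |Δ j| := by
      refine Finset.sum_congr rfl fun j hj => ?_
      have : γ₀ j = 0 := by simpa [support] using hj
      simp [hΔ, this]
    have h3 : ∑ j ∈ support γ₀, |γ₀ j|
        ≤ ∑ j ∈ support γ₀, |γhat j| + ∑ j ∈ support γ₀, |Δ j| := by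
      rw [← Finset.sum_add_distrib]
      refine Finset.sum_le_sum fun j _ => ?_
      have : γ₀ j = γhat j - Δ j := by simp [hΔ]
      rw [this]
      exact abs_sub _ _
    linarith
  rw [← Finset.sum_add_sum_compl (support γ₀) (fun j => |Δ j|)] at hsc
  rw [← hgh] at hloss
  have := mul_le_mul_of_nonneg_left hpen hlam
  linarith

theorem norm_sub_le_of_isL1Estimator {z : Fin N → Obs p} {lam κ π : ℝ} {γ₀ γhat : Vec (p + 1)}
    (hκ : 0 < κ) (hπ : 0 < π) (hlam : 0 < lam)
    (hlamle : lam ≤ κ * π / (9 * √(sparsity γ₀)))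
    (ha : π / 2 ≤ labelFreq z) (ha1 : labelFreq z ≤ 1)
    (hscore : ∀ j, |score z (labelFreq z) γ₀ j| ≤ lam / 2)
    (hrsc : RSC z 1 γ₀ κ (coneBall (support γ₀)))
    (hγ : IsL1Estimator z lam γhat) :
    ‖γhat - γ₀‖ ≤ 9 * lam * √(sparsity γ₀) / (π * κ) := by
  set Δ := γhat - γ₀ with hΔ
  have ha0 : 0 < labelFreq z := by linarith
  -- At sparsity zero the division in `hlamle` returns `0`, which contradicts `0 < lam`.
  have hs : 0 < √(sparsity γ₀ : ℝ) := by
    by_contra hcon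
    have : √(sparsity γ₀ : ℝ) = 0 := le_antisymm (not_lt.1 hcon) (Real.sqrt_nonneg _)
    rw [this, mul_zero, div_zero] at hlamle
    linarith
  have hlams : 9 * lam * √(sparsity γ₀ : ℝ) ≤ κ * π := by
    rw [le_div_iff₀ (by positivity)] at hlamle
    linarith
  have hex := excessLoss_le_of_isL1Estimator ha0.le hscore hγ
  rw [← hΔ] at hex
  have hex0 := excessLoss_nonneg z ha0.le γ₀ Δ
  have hcone : ∑ j ∈ (support γ₀)ᶜ, |Δ j| ≤ 3 * ∑ j ∈ support γ₀, |Δ j| := by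
    have : lam * (∑ j ∈ (support γ₀)ᶜ, |Δ j|) ≤ lam * (3 * ∑ j ∈ support γ₀, |Δ j|) := by
      linarith
    exact le_of_mul_le_mul_left this hlam
  have hupper : excessLoss z Δ (labelFreq z) γ₀ ≤ 3 / 2 * lam * (√(sparsity γ₀) * ‖Δ‖) := by
    have h1 := mul_le_mul_of_nonneg_left (sum_support_abs_le (support γ₀) Δ)
      (show 0 ≤ 3 / 2 * lam by linarith)
    have h2 : 0 ≤ lam / 2 * ∑ j ∈ (support γ₀)ᶜ, |Δ j| :=
      mul_nonneg (by linarith) (Finset.sum_nonneg fun _ _ => abs_nonneg _)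
    unfold sparsity
    linarith
  have hlow := mul_excessLoss_one_le z ha0.le ha1 γ₀ Δ
  -- A longer increment is rescaled to norm one inside the cone; convexity then gives growth at
  -- least `κ ‖Δ‖`, linear in the norm, which beats the upper bound by the size restriction on
  -- `lam`.
  have hnorm : ‖Δ‖ ≤ 1 := by
    by_contra! hcon
    have hpos : 0 < ‖Δ‖ := by linarith
    set t := ‖Δ‖⁻¹ with ht
    have ht0 : 0 < t := inv_pos.2 hpos
    have ht1 : t ≤ 1 := inv_le_one_of_one_le₀ hcon.le
    have hmem : t • Δ ∈ coneBall (support γ₀) := by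
      refine ⟨?_, ?_⟩
      · simp only [PiLp.smul_apply, smul_eq_mul, abs_mul, abs_of_pos ht0, ← Finset.mul_sum]
        nlinarith
      · rw [norm_smul, Real.norm_of_nonneg ht0.le, ht, inv_mul_cancel₀ hpos.ne']
    have h1 := hrsc _ hmem
    rw [norm_smul, Real.norm_of_nonneg ht0.le, ht, inv_mul_cancel₀ hpos.ne', one_pow, mul_one,
      ← ht] at h1
    have h2 := h1.trans (excessLoss_smul_le z ht0.le ht1 γ₀ Δ)
    have h3 : κ * ‖Δ‖ ≤ excessLoss z Δ 1 γ₀ := by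
      rw [ht, inv_mul_eq_div, le_div_iff₀ hpos] at h2
      exact h2
    have h4 : π / 2 * (κ * ‖Δ‖) ≤ 3 / 2 * lam * (√(sparsity γ₀) * ‖Δ‖) :=
      (mul_le_mul ha h3 (by positivity) ha0.le).trans (hlow.trans hupper)
    have h5 : π / 2 * κ ≤ 3 / 2 * lam * √(sparsity γ₀) := by
      refine le_of_mul_le_mul_right ?_ hpos
      linarith
    nlinarith [mul_pos hκ hπ]
  -- Quadratic growth against a linear upper bound gives the constant `3`; the stated `9` leaves
  -- slack.
  have h1 := hrsc Δ ⟨hcone, hnorm⟩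
  have h4 : π / 2 * (κ * ‖Δ‖ ^ 2) ≤ 3 / 2 * lam * (√(sparsity γ₀) * ‖Δ‖) :=
    (mul_le_mul ha h1 (by positivity) ha0.le).trans (hlow.trans hupper)
  rw [le_div_iff₀ (by positivity)]
  rcases (norm_nonneg Δ).eq_or_lt with h0 | hpos
  · rw [← h0, zero_mul]; positivity
  · have h5 : π / 2 * κ * ‖Δ‖ ≤ 3 / 2 * lam * √(sparsity γ₀) := by
      refine le_of_mul_le_mul_right ?_ hpos
      nlinarith
    have : 0 ≤ lam * √(sparsity γ₀ : ℝ) := by positivity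
    linarith

end Loss

/-! ### Sub-Gaussian moments -/

theorem exp_le_one_add_self_add_sq_mul_exp_abs (x : ℝ) :
    Real.exp x ≤ 1 + x + x ^ 2 * Real.exp |x| := by
  have h := Complex.norm_exp_sub_sum_le_norm_mul_exp (x : ℂ) 2
  have h2 : Complex.exp x - ∑ m ∈ Finset.range 2, (x : ℂ) ^ m / (m.factorial : ℂ)
      = ((Real.exp x - (1 + x) : ℝ) : ℂ) := by
    simp [Finset.sum_range_succ]
  rw [h2, Complex.norm_real, Complex.norm_real, Real.norm_eq_abs, Real.norm_eq_abs, sq_abs] at h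
  linarith [le_abs_self (Real.exp x - (1 + x))]

theorem exp_le_one_add_mul_exp (x : ℝ) : Real.exp x ≤ 1 + x * Real.exp x := by
  have h := Real.add_one_le_exp (-x)
  have h2 : Real.exp (-x) * Real.exp x = 1 := by rw [← Real.exp_add]; simp
  nlinarith [Real.exp_pos x]

theorem sq_le_exp_two_mul_abs (y : ℝ) : y ^ 2 ≤ Real.exp (2 * |y|) := by
  have h : |y| ≤ Real.exp |y| := by linarith [Real.add_one_le_exp |y|]
  rw [two_mul, Real.exp_add, ← sq_abs, pow_two]
  exact mul_le_mul h h (abs_nonneg _) (Real.exp_pos _).le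

/-- The scale is doubled to avoid showing that the infimum defining the norm is attained: some
admissible `t` lies strictly below `2 * s`. -/
theorem lintegral_exp_sq_le_two {α : Type*} [MeasurableSpace α] {μ : Measure α} {W : α → ℝ}
    {s : ℝ} (hs : 0 < s) (h : psi2Norm μ W ≤ ENNReal.ofReal s) :
    ∫⁻ x, ENNReal.ofReal (Real.exp (W x ^ 2 / (2 * s) ^ 2)) ∂μ ≤ 2 := by
  have hlt : psi2Norm μ W < ENNReal.ofReal (2 * s) :=
    h.trans_lt ((ENNReal.ofReal_lt_ofReal_iff (by positivity)).2 (by linarith))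
  simp only [psi2Norm, iInf_lt_iff] at hlt
  obtain ⟨t, ⟨ht, hle⟩, hts⟩ := hlt
  rw [ENNReal.ofReal_lt_ofReal_iff (by positivity)] at hts
  refine le_trans (lintegral_mono fun x => ?_) hle
  refine ENNReal.ofReal_le_ofReal (Real.exp_le_exp.2 ?_)
  gcongr

/-- Completing the square gives `k |W| ≤ k² s² + W² / (2 s)²`. -/
theorem lintegral_exp_mul_abs_le {α : Type*} [MeasurableSpace α] {μ : Measure α} {W : α → ℝ}
    {s : ℝ} (hs : 0 < s) (h : psi2Norm μ W ≤ ENNReal.ofReal s) (k : ℝ) :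
    ∫⁻ x, ENNReal.ofReal (Real.exp (k * |W x|)) ∂μ
      ≤ ENNReal.ofReal (2 * Real.exp (k ^ 2 * s ^ 2)) := by
  have hpt : ∀ x, ENNReal.ofReal (Real.exp (k * |W x|))
      ≤ ENNReal.ofReal (Real.exp (k ^ 2 * s ^ 2))
        * ENNReal.ofReal (Real.exp (W x ^ 2 / (2 * s) ^ 2)) := by
    intro x
    rw [← ENNReal.ofReal_mul (Real.exp_pos _).le, ← Real.exp_add]
    refine ENNReal.ofReal_le_ofReal (Real.exp_le_exp.2 ?_)
    have h1 : k ^ 2 * s ^ 2 + W x ^ 2 / (2 * s) ^ 2 - k * |W x|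
        = (k * s - |W x| / (2 * s)) ^ 2 := by
      rw [← sq_abs (W x)]
      field_simp
      ring
    nlinarith [sq_nonneg (k * s - |W x| / (2 * s))]
  refine (lintegral_mono hpt).trans ?_
  rw [lintegral_const_mul' _ _ ENNReal.ofReal_ne_top, mul_comm (2 : ℝ) (Real.exp _),
    ENNReal.ofReal_mul (Real.exp_pos _).le]
  gcongr
  simpa using lintegral_exp_sq_le_two hs h

theorem integrable_exp_mul_abs {α : Type*} [MeasurableSpace α] {μ : Measure α} {W : α → ℝ}
    {s : ℝ} (hs : 0 < s) (hW : Measurable W) (h : psi2Norm μ W ≤ ENNReal.ofReal s) (k : ℝ) :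
    Integrable (fun x => Real.exp (k * |W x|)) μ := by
  refine ⟨by fun_prop, ?_⟩
  rw [hasFiniteIntegral_iff_ofReal (ae_of_all _ fun x => (Real.exp_pos _).le)]
  exact (lintegral_exp_mul_abs_le hs h k).trans_lt ENNReal.ofReal_lt_top

theorem integral_exp_mul_abs_le {α : Type*} [MeasurableSpace α] {μ : Measure α} {W : α → ℝ}
    {s : ℝ} (hs : 0 < s) (hW : Measurable W) (h : psi2Norm μ W ≤ ENNReal.ofReal s) (k : ℝ) :
    ∫ x, Real.exp (k * |W x|) ∂μ ≤ 2 * Real.exp (k ^ 2 * s ^ 2) := by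
  rw [← ENNReal.ofReal_le_ofReal_iff (by positivity),
    ofReal_integral_eq_lintegral_ofReal (integrable_exp_mul_abs hs hW h k)
      (ae_of_all _ fun x => (Real.exp_pos _).le)]
  exact lintegral_exp_mul_abs_le hs h k

/-! ### Concentration of sample averages -/

section Concentration

variable {Ω : Type*} [MeasurableSpace Ω] {p N : ℕ} {P : Measure Ω} [IsProbabilityMeasure P]
  {Z : Fin N → Ω → Obs p} {Q : Measure (Obs p)}

/-- Chernoff's bound at one fixed `θ`, with `ψ` bounding the log moment generating function of a
single observation. -/
theorem measure_average_ge_le_exp (hZ : IsIIDSample P Z Q) (hN : 0 < N) {f : Obs p → ℝ}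
    (hf : Measurable f) {θ : ℝ} (hθ : 0 < θ) (hint : Integrable (fun z => Real.exp (θ * f z)) Q)
    {ψ : ℝ} (hψ : ∫ z, Real.exp (θ * f z) ∂Q ≤ Real.exp ψ) (t : ℝ) :
    P.real {ω | (ψ + t / N) / θ ≤ (N : ℝ)⁻¹ * ∑ i, f (Z i ω)} ≤ Real.exp (-t) := by
  obtain ⟨hmeas, hind, hlaw⟩ := hZ
  have hN' : (0 : ℝ) < N := by exact_mod_cast hN
  have hfm : ∀ i, Measurable (fun ω => f (Z i ω)) := fun i => hf.comp (hmeas i)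
  have hind' : iIndepFun (fun i ω => f (Z i ω)) P := hind.comp (fun _ => f) (fun _ => hf)
  have hinti : ∀ i, Integrable (fun ω => Real.exp (θ * f (Z i ω))) P := by
    intro i
    have : Integrable (fun z => Real.exp (θ * f z)) (P.map (Z i)) := by rwa [hlaw i]
    exact this.comp_measurable (hmeas i)
  have hmgf : ∀ i, mgf (fun ω => f (Z i ω)) P θ = ∫ z, Real.exp (θ * f z) ∂Q := by
    intro i
    rw [mgf, ← hlaw i, integral_map (hmeas i).aemeasurable (by fun_prop)]
  have hset : {ω | (ψ + t / N) / θ ≤ (N : ℝ)⁻¹ * ∑ i, f (Z i ω)}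
      = {ω | N * ((ψ + t / N) / θ) ≤ (∑ i, fun ω => f (Z i ω)) ω} := by
    ext ω
    simp only [Set.mem_ofPred_eq, Finset.sum_apply]
    rw [inv_mul_eq_div, le_div_iff₀' hN']
  rw [hset]
  refine (measure_ge_le_exp_mul_mgf _ hθ.le ?_).trans ?_
  · exact hind'.integrable_exp_mul_sum hfm fun i _ => hinti i
  rw [hind'.mgf_sum hfm]
  simp only [hmgf, Finset.prod_const, Finset.card_univ, Fintype.card_fin]
  have h1 : (∫ z, Real.exp (θ * f z) ∂Q) ^ N ≤ Real.exp (N * ψ) := by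
    rw [Real.exp_nat_mul]
    exact pow_le_pow_left₀ (integral_nonneg fun z => (Real.exp_pos _).le) hψ N
  refine (mul_le_mul_of_nonneg_left h1 (Real.exp_pos _).le).trans ?_
  rw [← Real.exp_add]
  refine Real.exp_le_exp.2 (le_of_eq ?_)
  field_simp
  ring

/-- Bernstein's inequality under an exponentially weighted second moment. -/
theorem measure_average_ge_le_of_sq_mul_exp (hZ : IsIIDSample P Z Q) (hN : 0 < N)
    [IsProbabilityMeasure Q] {f : Obs p → ℝ} (hf : Measurable f)
    (hfi : Integrable f Q) (hf0 : ∫ z, f z ∂Q = 0)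
    (hexp : Integrable (fun z => Real.exp |f z|) Q)
    (hsq : Integrable (fun z => f z ^ 2 * Real.exp |f z|) Q) {v : ℝ} (hv : 0 < v)
    (hle : ∫ z, f z ^ 2 * Real.exp |f z| ∂Q ≤ v) {t : ℝ} (ht : 0 < t) :
    P.real {ω | 2 * √(v * t / N) + 2 * t / N ≤ (N : ℝ)⁻¹ * ∑ i, f (Z i ω)} ≤ Real.exp (-t) := by
  have hN' : (0 : ℝ) < N := by exact_mod_cast hN
  have hmgf : ∀ θ : ℝ, 0 < θ → θ ≤ 1 → Integrable (fun z => Real.exp (θ * f z)) Q ∧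
      ∫ z, Real.exp (θ * f z) ∂Q ≤ Real.exp (θ ^ 2 * v) := by
    intro θ hθ hθ1
    have habs : ∀ z, |θ * f z| ≤ |f z| := fun z => by
      rw [abs_mul, abs_of_pos hθ]
      exact mul_le_of_le_one_left (abs_nonneg _) hθ1
    have hint : Integrable (fun z => Real.exp (θ * f z)) Q := by
      refine hexp.mono' (by fun_prop) (ae_of_all _ fun z => ?_)
      rw [Real.norm_of_nonneg (Real.exp_pos _).le]
      exact Real.exp_le_exp.2 ((le_abs_self _).trans (habs z))
    refine ⟨hint, ?_⟩
    have hpt : ∀ z, Real.exp (θ * f z)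
        ≤ 1 + θ * f z + θ ^ 2 * (f z ^ 2 * Real.exp |f z|) := by
      intro z
      refine (exp_le_one_add_self_add_sq_mul_exp_abs _).trans ?_
      have := Real.exp_le_exp.2 (habs z)
      have h2 : (θ * f z) ^ 2 * Real.exp |θ * f z| ≤ (θ * f z) ^ 2 * Real.exp |f z| := by gcongr
      linarith [mul_pow θ (f z) 2, mul_assoc (θ ^ 2) (f z ^ 2) (Real.exp |f z|),
        congrArg (· * Real.exp |f z|) (mul_pow θ (f z) 2)]
    have hi1 : Integrable (fun z => 1 + θ * f z) Q := (integrable_const _).add (hfi.const_mul θ)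
    have hi2 := hsq.const_mul (θ ^ 2)
    have h3 := integral_mono hint (hi1.add hi2) hpt
    simp only [Pi.add_apply] at h3
    rw [integral_add hi1 hi2, integral_add (integrable_const _) (hfi.const_mul θ),
      integral_const_mul, integral_const_mul, hf0] at h3
    simp only [integral_const, probReal_univ, smul_eq_mul, mul_one, mul_zero, add_zero] at h3
    have h4 : θ ^ 2 * ∫ z, f z ^ 2 * Real.exp |f z| ∂Q ≤ θ ^ 2 * v := by gcongr
    linarith [Real.add_one_le_exp (θ ^ 2 * v)]
  -- This `r` minimizes `(θ ^ 2 * v + t / N) / θ`, with value `2 v r`. The moment bound holds only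
  -- for `θ ≤ 1`; when `r ≥ 1`, take `θ = 1`, where `v ≤ t / N` gives the linear term.
  set r := √(t / (N * v)) with hr
  have hrpos : 0 < r := Real.sqrt_pos.2 (by positivity)
  have hrsq : r ^ 2 = t / (N * v) := Real.sq_sqrt (by positivity)
  have hvr : √(v * t / N) = v * r := by
    rw [show v * t / N = (v * r) ^ 2 by rw [mul_pow, hrsq]; field_simp]
    exact Real.sqrt_sq (by positivity)
  rw [hvr]
  rcases le_total r 1 with h1 | h1
  · obtain ⟨hi, hm⟩ := hmgf r hrpos h1
    refine le_trans (measureReal_mono fun ω hω => ?_)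
      (measure_average_ge_le_exp hZ hN hf hrpos hi hm t)
    simp only [Set.mem_ofPred_eq] at hω ⊢
    refine le_trans ?_ hω
    have : t / N = r ^ 2 * v := by rw [hrsq]; field_simp
    rw [this, div_le_iff₀ hrpos]
    have : 0 ≤ 2 * t / N * r := by positivity
    nlinarith
  · obtain ⟨hi, hm⟩ := hmgf 1 one_pos le_rfl
    refine le_trans (measureReal_mono fun ω hω => ?_)
      (measure_average_ge_le_exp hZ hN hf one_pos hi hm t)
    simp only [Set.mem_ofPred_eq] at hω ⊢
    refine le_trans ?_ hω
    have : t / N = r ^ 2 * v := by rw [hrsq]; field_simp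
    have h2 : v ≤ r ^ 2 * v := le_mul_of_one_le_left hv.le (one_le_pow₀ h1)
    have h3 : 0 ≤ v * r := by positivity
    rw [mul_div_assoc]
    linarith

end Concentration

/-! ### Moments under the offset model -/

section Model

variable {p : ℕ} {Q : Measure (Obs p)} {γ₀ : Vec (p + 1)}

@[fun_prop]
theorem measurable_augment_apply (j : Fin (p + 1)) :
    Measurable (fun x : Vec p => augment x j) := by
  refine Fin.cases ?_ (fun k => ?_) j
  · simp [augment]
  · simp only [augment, Fin.cons_succ]
    fun_prop

@[fun_prop]
theorem measurable_linPred (γ : Vec (p + 1)) : Measurable (linPred γ : Vec p → ℝ) := by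
  have : (linPred γ : Vec p → ℝ) = fun x => ∑ j, γ j * augment x j :=
    funext fun x => linPred_eq_sum γ x
  rw [this]
  fun_prop

@[fun_prop]
theorem measurable_link (a : ℝ) : Measurable (link a) := by
  unfold link
  fun_prop

theorem measurable_cov : Measurable (fun z : Obs p => z.2.2) := by fun_prop

theorem integrable_cov {g : Vec p → ℝ} (hi : Integrable g (covLaw Q)) :
    Integrable (fun z => g z.2.2) Q :=
  Integrable.comp_measurable hi measurable_cov

theorem integral_cov {g : Vec p → ℝ} (hg : Measurable g) :
    ∫ z, g z.2.2 ∂Q = ∫ x, g x ∂(covLaw Q) := by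
  rw [covLaw, integral_map measurable_cov.aemeasurable hg.aestronglyMeasurable]

theorem IsOffsetModel.isProbabilityMeasure_covLaw (h : IsOffsetModel Q γ₀) :
    IsProbabilityMeasure (covLaw Q) :=
  have := h.prob
  Measure.isProbabilityMeasure_map measurable_cov.aemeasurable

theorem IsOffsetModel.labelProb_le_one (h : IsOffsetModel Q γ₀) : labelProb Q ≤ 1 :=
  have := h.prob
  measureReal_le_one

theorem IsOffsetModel.integrable_label_mul (h : IsOffsetModel Q γ₀) {g : Obs p → ℝ}
    (hi : Integrable g Q) : Integrable (fun z => z.1 * g z) Q := by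
  refine hi.norm.mono' (measurable_fst.aestronglyMeasurable.mul hi.1) ?_
  filter_upwards [h.binary] with z hz
  rcases hz with hz | hz <;> simp [hz]

/-- Condition on the covariates and pull out `g`. This is where the form of the propensity score
enters the probabilistic estimates. -/
theorem IsOffsetModel.integral_label_mul (h : IsOffsetModel Q γ₀) {g : Vec p → ℝ}
    (hg : Measurable g) (hi : Integrable g (covLaw Q)) :
    ∫ z, z.1 * g z.2.2 ∂Q
      = ∫ x, link (labelProb Q) (linPred γ₀ x) * g x ∂(covLaw Q) := by
  have := h.prob
  have hm : covSigma p ≤ (inferInstance : MeasurableSpace (Obs p)) := measurable_cov.comap_le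
  have hR : Integrable (fun z : Obs p => z.1) Q := by
    simpa using h.integrable_label_mul (integrable_const (1 : ℝ))
  have hsm : StronglyMeasurable[covSigma p] (fun z : Obs p => g z.2.2) :=
    (hg.comp (comap_measurable _)).stronglyMeasurable
  have hpull := condExp_mul_of_stronglyMeasurable_right hsm
    (h.integrable_label_mul (integrable_cov hi)) hR
  rw [← integral_cov (by fun_prop), ← integral_condExp hm]
  refine integral_congr_ae ?_
  filter_upwards [hpull, h.propensity] with z h1 h2
  rw [← offsetPS_eq_link, ← h2]
  exact h1

theorem IsOffsetModel.integral_label (h : IsOffsetModel Q γ₀) : ∫ z, z.1 ∂Q = labelProb Q := by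
  have := h.prob
  have hs : MeasurableSet {z : Obs p | z.1 = 1} := measurable_fst (measurableSet_singleton 1)
  rw [labelProb, ← integral_indicator_one hs]
  refine integral_congr_ae ?_
  filter_upwards [h.binary] with z hz
  rcases hz with hz | hz <;> simp [hz, Set.indicator]

theorem IsOffsetModel.integral_link (h : IsOffsetModel Q γ₀) :
    ∫ x, link (labelProb Q) (linPred γ₀ x) ∂(covLaw Q) = labelProb Q := by
  have := h.isProbabilityMeasure_covLaw
  have h1 := h.integral_label_mul (g := fun _ => 1) measurable_const (integrable_const _)
  simp only [mul_one] at h1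
  rw [← h1, h.integral_label]

/-- The parameter of an offset model is never zero, as the offset is the marginal probability. -/
theorem IsOffsetModel.sparsity_pos (h : IsOffsetModel Q γ₀) : 0 < sparsity γ₀ := by
  have := h.isProbabilityMeasure_covLaw
  have hpos := h.labelProb_pos
  rw [sparsity, Finset.card_pos]
  by_contra hcon
  have hz : ∀ j, γ₀ j = 0 := fun j => by
    by_contra hj
    exact hcon ⟨j, by simp [support, hj]⟩
  have h1 := h.integral_link
  have h2 : ∀ x : Vec p, linPred γ₀ x = 0 := fun x => by simp [linPred_eq_sum, hz]
  -- A zero parameter would force `π / (1 + π) = π`, impossible for `π > 0`.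
  simp only [h2, link, Real.exp_zero, mul_one, integral_const, probReal_univ, one_smul] at h1
  rw [div_eq_iff (by positivity)] at h1
  nlinarith

/-- A bound, free of the law, for the exponential moments used below. -/
noncomputable def momentBound (σ σγ : ℝ) : ℝ :=
  2 * Real.exp (4 * σγ ^ 2) + 2 * Real.exp (36 * σ ^ 2)

theorem two_le_momentBound (σ σγ : ℝ) : 2 ≤ momentBound σ σγ := by
  have h1 : 1 ≤ Real.exp (4 * σγ ^ 2) := Real.one_le_exp (by positivity)
  have h2 := Real.exp_pos (36 * σ ^ 2)
  unfold momentBound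
  linarith

variable {σ σγ : ℝ}

/-- Since `link π u ≤ π eᵘ`, the factor `π` comes out, and the product of two exponentials is split
by the arithmetic-geometric mean inequality. The exponents `2` and `6` so produced explain `4 σγ²`
and `36 σ²` in `momentBound`. The factor `3` covers `y² e^{|y|} ≤ e^{3|y|}`. -/
theorem IsOffsetModel.integral_link_mul_exp_le (h : IsOffsetModel Q γ₀) (hσ : 0 < σ)
    (hσγ : 0 < σγ) (hlin : psi2Norm (covLaw Q) (linPred γ₀) ≤ ENNReal.ofReal σγ)
    {j : Fin (p + 1)} (hcov : psi2Norm (covLaw Q) (fun x => augment x j) ≤ ENNReal.ofReal σ) :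
    ∫ x, link (labelProb Q) (linPred γ₀ x) * Real.exp (3 * |augment x j|) ∂(covLaw Q)
      ≤ labelProb Q * (momentBound σ σγ / 2) := by
  have hpos := h.labelProb_pos
  have hi1 := integrable_exp_mul_abs hσγ (measurable_linPred γ₀) hlin 2
  have hi2 := integrable_exp_mul_abs hσ (measurable_augment_apply j) hcov 6
  have hb1 := integral_exp_mul_abs_le hσγ (measurable_linPred γ₀) hlin 2
  have hb2 := integral_exp_mul_abs_le hσ (measurable_augment_apply j) hcov 6
  have hpt : ∀ x : Vec p, link (labelProb Q) (linPred γ₀ x) * Real.exp (3 * |augment x j|)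
      ≤ labelProb Q / 2 * (Real.exp (2 * |linPred γ₀ x|) + Real.exp (6 * |augment x j|)) := by
    intro x
    have h1 := link_le_mul_exp hpos.le (linPred γ₀ x)
    have h2 : Real.exp (linPred γ₀ x) ≤ Real.exp |linPred γ₀ x| :=
      Real.exp_le_exp.2 (le_abs_self _)
    have h3 : Real.exp (2 * |linPred γ₀ x|) = Real.exp |linPred γ₀ x| ^ 2 := by
      rw [← Real.exp_nat_mul]; norm_num
    have h4 : Real.exp (6 * |augment x j|) = Real.exp (3 * |augment x j|) ^ 2 := by
      rw [← Real.exp_nat_mul]; norm_num; ring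
    rw [h3, h4]
    have h5 := sq_nonneg (Real.exp |linPred γ₀ x| - Real.exp (3 * |augment x j|))
    calc _ ≤ labelProb Q * Real.exp |linPred γ₀ x| * Real.exp (3 * |augment x j|) := by
          gcongr
          exact h1.trans (by gcongr)
      _ ≤ _ := by nlinarith
  refine (integral_mono_of_nonneg (ae_of_all _ fun x => ?_) ((hi1.add hi2).const_mul _)
    (ae_of_all _ hpt)).trans ?_
  · exact mul_nonneg (link_nonneg hpos.le _) (Real.exp_pos _).le
  · simp only [Pi.add_apply]
    rw [integral_const_mul, integral_add hi1 hi2, momentBound, div_mul_eq_mul_div, mul_div_assoc]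
    norm_num at hb1 hb2 ⊢
    refine mul_le_mul_of_nonneg_left ?_ hpos.le
    linarith

end Model

/-! ### The event on which the penalty dominates the score -/

section GoodEvent

variable {Ω : Type*} [MeasurableSpace Ω] {p N : ℕ} {P : Measure Ω} [IsProbabilityMeasure P]
  {Z : Fin N → Ω → Obs p} {Q : Measure (Obs p)} {γ₀ : Vec (p + 1)} {σ σγ : ℝ}

/-- One two-sided Bernstein bound serves both the score (`h` the propensity, `g` a covariate) and
the label frequency (`h` constant, `g = 1`). -/
theorem measure_abs_average_residual_ge_le (hM : IsOffsetModel Q γ₀) (hZ : IsIIDSample P Z Q)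
    (hN : 0 < N) {h g : Vec p → ℝ} (hh : Measurable h) (hg : Measurable g)
    (h0 : ∀ x, 0 ≤ h x) (h1 : ∀ x, h x ≤ 1)
    (hgi : Integrable (fun x => Real.exp (3 * |g x|)) (covLaw Q))
    (hmean : ∫ z, (z.1 - h z.2.2) * g z.2.2 ∂Q = 0) {v : ℝ} (hv : 0 < v)
    (hle : ∫ x, link (labelProb Q) (linPred γ₀ x) * Real.exp (3 * |g x|) ∂(covLaw Q)
      + ∫ x, h x * Real.exp (3 * |g x|) ∂(covLaw Q) ≤ v) {t : ℝ} (ht : 0 < t) :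
    P.real {ω | 2 * √(v * t / N) + 2 * t / N
      ≤ |(N : ℝ)⁻¹ * ∑ i, ((Z i ω).1 - h (Z i ω).2.2) * g (Z i ω).2.2|} ≤ 2 * Real.exp (-t) := by
  have := hM.prob
  set f : Obs p → ℝ := fun z => (z.1 - h z.2.2) * g z.2.2 with hf
  have hfm : Measurable f := by fun_prop
  have hE : Integrable (fun z : Obs p => Real.exp (3 * |g z.2.2|)) Q := integrable_cov hgi
  have habs : ∀ᵐ z ∂Q, |f z| ≤ |g z.2.2| := by
    filter_upwards [hM.binary] with z hz
    rw [hf, abs_mul]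
    refine mul_le_of_le_one_left (abs_nonneg _) ?_
    rw [abs_le]
    rcases hz with hz | hz <;> constructor <;> rw [hz] <;> linarith [h0 z.2.2, h1 z.2.2]
  have hexp3 : ∀ y : ℝ, 0 ≤ y → Real.exp y ≤ Real.exp (3 * y) := fun y hy =>
    Real.exp_le_exp.2 (by linarith)
  have hfi : Integrable f Q := by
    refine hE.mono' hfm.aestronglyMeasurable ?_
    filter_upwards [habs] with z hz
    rw [Real.norm_eq_abs]
    have := Real.add_one_le_exp |g z.2.2|
    linarith [hexp3 |g z.2.2| (abs_nonneg _)]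
  have hei : Integrable (fun z => Real.exp |f z|) Q := by
    refine hE.mono' (by fun_prop) ?_
    filter_upwards [habs] with z hz
    rw [Real.norm_of_nonneg (Real.exp_pos _).le]
    exact (Real.exp_le_exp.2 hz).trans (hexp3 _ (abs_nonneg _))
  have hdom : ∀ᵐ z ∂Q, f z ^ 2 * Real.exp |f z|
      ≤ z.1 * Real.exp (3 * |g z.2.2|) + h z.2.2 * Real.exp (3 * |g z.2.2|) := by
    filter_upwards [habs, hM.binary] with z hz hb
    -- For a binary label the squared residual is dominated by a quantity whose mean is of order `π`
    -- in both applications, so the variance proxy keeps that factor.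
    have h3 : (z.1 - h z.2.2) ^ 2 ≤ z.1 + h z.2.2 := by
      rcases hb with hb | hb <;> rw [hb] <;> nlinarith [h0 z.2.2, h1 z.2.2]
    have h4 : g z.2.2 ^ 2 * Real.exp |f z| ≤ Real.exp (3 * |g z.2.2|) := by
      rw [show 3 * |g z.2.2| = 2 * |g z.2.2| + |g z.2.2| by ring, Real.exp_add]
      exact mul_le_mul (sq_le_exp_two_mul_abs _) (Real.exp_le_exp.2 hz) (Real.exp_pos _).le
        (Real.exp_pos _).le
    rw [← add_mul]
    calc f z ^ 2 * Real.exp |f z| = (z.1 - h z.2.2) ^ 2 * (g z.2.2 ^ 2 * Real.exp |f z|) := by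
          rw [hf]; ring
      _ ≤ _ := mul_le_mul h3 h4 (by positivity) ((sq_nonneg _).trans h3)
  have hR := hM.integrable_label_mul hE
  have hhi : Integrable (fun z : Obs p => h z.2.2 * Real.exp (3 * |g z.2.2|)) Q := by
    refine hE.mono' (by fun_prop) (ae_of_all _ fun z => ?_)
    rw [Real.norm_of_nonneg (mul_nonneg (h0 _) (Real.exp_pos _).le)]
    exact mul_le_of_le_one_left (Real.exp_pos _).le (h1 _)
  have hsi : Integrable (fun z => f z ^ 2 * Real.exp |f z|) Q := by
    refine (hR.add hhi).mono' (by fun_prop) ?_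
    filter_upwards [hdom] with z hz
    rw [Real.norm_of_nonneg (by positivity)]
    exact hz
  have hsle : ∫ z, f z ^ 2 * Real.exp |f z| ∂Q ≤ v := by
    refine (integral_mono_ae hsi (hR.add hhi) hdom).trans ?_
    simp only [Pi.add_apply]
    rw [integral_add hR hhi, hM.integral_label_mul (g := fun x => Real.exp (3 * |g x|))
      (by fun_prop) hgi, integral_cov (g := fun x => h x * Real.exp (3 * |g x|)) (by fun_prop)]
    exact hle
  have hup := measure_average_ge_le_of_sq_mul_exp hZ hN hfm hfi hmean hei hsi hv hsle ht
  have hlo := measure_average_ge_le_of_sq_mul_exp hZ hN (f := fun z => -f z) hfm.neg hfi.neg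
    (by rw [integral_neg, hmean, neg_zero]) (by simpa using hei) (by simpa using hsi) hv
    (by simpa using hsle) ht
  refine (measureReal_mono (s₂ := _ ∪ _) fun ω hω => ?_).trans
    ((measureReal_union_le _ _).trans ((add_le_add hup hlo).trans_eq (two_mul _).symm))
  simp only [Set.mem_union, Set.mem_ofPred_eq, Finset.sum_neg_distrib, mul_neg] at hω ⊢
  exact le_abs.1 hω

theorem measure_abs_labelFreq_sub_ge_le (hM : IsOffsetModel Q γ₀) (hZ : IsIIDSample P Z Q)
    (hN : 0 < N) {t : ℝ} (ht : 0 < t) (htN : 9 * t ≤ N * labelProb Q) :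
    P.real {ω | 14 * √(labelProb Q * t / N) ≤ |labelFreq (fun i => Z i ω) - labelProb Q|}
      ≤ 2 * Real.exp (-t) := by
  have := hM.prob
  have := hM.isProbabilityMeasure_covLaw
  have hN' : (0 : ℝ) < N := by exact_mod_cast hN
  have hpos := hM.labelProb_pos
  have hexp : Real.exp 3 ≤ 21 := by
    have h1 := Real.exp_one_lt_d9
    have h2 : Real.exp 3 = Real.exp 1 ^ 3 := by rw [← Real.exp_nat_mul]; norm_num
    rw [h2]
    calc Real.exp 1 ^ 3 ≤ 2.7182818286 ^ 3 := by gcongr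
      _ ≤ 21 := by norm_num
  -- Both second moment terms equal `e³ π ≤ 21 π`, hence `42`. Then `√42 ≤ 13 / 2`, and `9 t ≤ N π`
  -- bounds the linear term by `2 / 3` of the root, for a total below `14`.
  have key := measure_abs_average_residual_ge_le hM hZ hN (h := fun _ => labelProb Q)
    (g := fun _ => 1) measurable_const measurable_const (fun _ => hpos.le)
    (fun _ => hM.labelProb_le_one) (integrable_const _) ?_ (v := 42 * labelProb Q) (by positivity)
    ?_ ht
  · refine (measureReal_mono fun ω hω => ?_).trans key
    simp only [Set.mem_ofPred_eq] at hω ⊢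
    have h1 : (N : ℝ)⁻¹ * ∑ i, ((Z i ω).1 - labelProb Q) * 1
        = labelFreq (fun i => Z i ω) - labelProb Q := by
      simp only [mul_one, Finset.sum_sub_distrib, Finset.sum_const, Finset.card_univ,
        Fintype.card_fin, nsmul_eq_mul, labelFreq]
      field_simp
    rw [h1]
    refine le_trans ?_ hω
    set r := √(labelProb Q * t / N) with hr
    have hr0 : 0 ≤ r := Real.sqrt_nonneg _
    have hrsq : r ^ 2 = labelProb Q * t / N := Real.sq_sqrt (by positivity)
    have h2 : √(42 * labelProb Q * t / N) ≤ 13 / 2 * r := by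
      refine Real.sqrt_le_iff.2 ⟨by positivity, ?_⟩
      rw [mul_pow, hrsq, mul_assoc, mul_div_assoc]
      have : 0 ≤ labelProb Q * t / N := by positivity
      linarith
    have h3 : t / N ≤ 1 / 3 * r := by
      refine abs_le_of_sq_le_sq' ?_ (by positivity) |>.2
      rw [mul_pow, hrsq, div_pow, div_le_iff₀ (by positivity)]
      have : labelProb Q * t / N * N ^ 2 = t * (N * labelProb Q) := by field_simp
      nlinarith
    rw [mul_div_assoc 2 t]
    linarith
  · simp only [mul_one]
    have hR : Integrable (fun z : Obs p => z.1) Q := by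
      simpa using hM.integrable_label_mul (integrable_const (1 : ℝ))
    rw [integral_sub hR (integrable_const _), hM.integral_label]
    simp
  · rw [integral_mul_const, hM.integral_link]
    simp only [abs_one, mul_one, integral_const, probReal_univ, one_smul]
    nlinarith

theorem measure_abs_score_ge_le (hM : IsOffsetModel Q γ₀) (hZ : IsIIDSample P Z Q) (hN : 0 < N)
    (hσ : 0 < σ) (hσγ : 0 < σγ) (hlin : psi2Norm (covLaw Q) (linPred γ₀) ≤ ENNReal.ofReal σγ)
    {j : Fin (p + 1)} (hcov : psi2Norm (covLaw Q) (fun x => augment x j) ≤ ENNReal.ofReal σ)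
    {t : ℝ} (ht : 0 < t) :
    P.real {ω | 2 * √(labelProb Q * momentBound σ σγ * t / N) + 2 * t / N
      ≤ |score (fun i => Z i ω) (labelProb Q) γ₀ j|} ≤ 2 * Real.exp (-t) := by
  have hpos := hM.labelProb_pos
  have hb := hM.integral_link_mul_exp_le hσ hσγ hlin hcov
  have hK := two_le_momentBound σ σγ
  have hgi := integrable_exp_mul_abs hσ (measurable_augment_apply j) hcov 3
  refine measure_abs_average_residual_ge_le hM hZ hN
    (h := fun x => link (labelProb Q) (linPred γ₀ x)) (g := fun x => augment x j) (by fun_prop)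
    (by fun_prop) (fun _ => link_nonneg hpos.le _) (fun _ => link_le_one hpos.le _) hgi ?_
    (by positivity) (by linarith) ht
  have hXi : Integrable (fun x : Vec p => augment x j) (covLaw Q) := by
    refine hgi.mono' (by fun_prop) (ae_of_all _ fun x => ?_)
    rw [Real.norm_eq_abs]
    have := Real.add_one_le_exp (3 * |augment x j|)
    linarith [abs_nonneg (augment x j)]
  have hLi : Integrable (fun x : Vec p => link (labelProb Q) (linPred γ₀ x) * augment x j)
      (covLaw Q) := by
    refine hXi.norm.mono' (by fun_prop) (ae_of_all _ fun x => ?_)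
    rw [norm_mul, Real.norm_of_nonneg (link_nonneg hpos.le _)]
    exact mul_le_of_le_one_left (norm_nonneg _) (link_le_one hpos.le _)
  simp only [sub_mul]
  rw [integral_sub (hM.integrable_label_mul (integrable_cov hXi)) (integrable_cov hLi),
    hM.integral_label_mul (by fun_prop) hXi, integral_cov
      (g := fun x => link (labelProb Q) (linPred γ₀ x) * augment x j) (by fun_prop), sub_self]

/-- Controls the factor multiplying the relative error of the label frequency in `abs_score_le`.
Chernoff at `θ = 1` suffices: `eᵛ ≤ 1 + v eᵛ` retains a factor `link`, and with it `π`. -/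
theorem measure_average_link_mul_abs_ge_le (hM : IsOffsetModel Q γ₀) (hZ : IsIIDSample P Z Q)
    (hN : 0 < N) (hσ : 0 < σ) (hσγ : 0 < σγ)
    (hlin : psi2Norm (covLaw Q) (linPred γ₀) ≤ ENNReal.ofReal σγ)
    {j : Fin (p + 1)} (hcov : psi2Norm (covLaw Q) (fun x => augment x j) ≤ ENNReal.ofReal σ)
    (t : ℝ) :
    P.real {ω | labelProb Q * (momentBound σ σγ / 2) + t / N ≤ (N : ℝ)⁻¹ *
      ∑ i, link (labelProb Q) (linPred γ₀ (Z i ω).2.2) * |augment (Z i ω).2.2 j|}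
      ≤ Real.exp (-t) := by
  have := hM.isProbabilityMeasure_covLaw
  have hpos := hM.labelProb_pos
  have hb := hM.integral_link_mul_exp_le hσ hσγ hlin hcov
  have hgi := integrable_exp_mul_abs hσ (measurable_augment_apply j) hcov 3
  have hV : ∀ x : Vec p, link (labelProb Q) (linPred γ₀ x) * |augment x j| ≤ |augment x j| :=
    fun x => mul_le_of_le_one_left (abs_nonneg _) (link_le_one hpos.le _)
  have hei : Integrable (fun x : Vec p =>
      Real.exp (1 * (link (labelProb Q) (linPred γ₀ x) * |augment x j|))) (covLaw Q) := by
    refine hgi.mono' (by fun_prop) (ae_of_all _ fun x => ?_)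
    rw [Real.norm_of_nonneg (Real.exp_pos _).le]
    refine Real.exp_le_exp.2 ?_
    linarith [hV x, abs_nonneg (augment x j)]
  have hgi' : Integrable (fun x : Vec p =>
      link (labelProb Q) (linPred γ₀ x) * Real.exp (3 * |augment x j|)) (covLaw Q) := by
    refine hgi.mono' (by fun_prop) (ae_of_all _ fun x => ?_)
    rw [Real.norm_of_nonneg (mul_nonneg (link_nonneg hpos.le _) (Real.exp_pos _).le)]
    exact mul_le_of_le_one_left (Real.exp_pos _).le (link_le_one hpos.le _)
  have hm : ∫ z, Real.exp (1 * (link (labelProb Q) (linPred γ₀ z.2.2) * |augment z.2.2 j|)) ∂Q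
      ≤ Real.exp (labelProb Q * (momentBound σ σγ / 2)) := by
    rw [integral_cov (g := fun x =>
      Real.exp (1 * (link (labelProb Q) (linPred γ₀ x) * |augment x j|))) (by fun_prop)]
    refine (integral_mono hei ((integrable_const 1).add hgi') fun x => ?_).trans ?_
    · simp only [Pi.add_apply, one_mul]
      refine (exp_le_one_add_mul_exp _).trans ?_
      rw [mul_assoc]
      refine add_le_add_right (mul_le_mul_of_nonneg_left ?_ (link_nonneg hpos.le _)) _
      rw [show 3 * |augment x j| = 2 * |augment x j| + |augment x j| by ring, Real.exp_add]
      refine mul_le_mul ?_ (Real.exp_le_exp.2 (hV x)) (Real.exp_pos _).le (Real.exp_pos _).le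
      linarith [Real.add_one_le_exp (2 * |augment x j|), abs_nonneg (augment x j)]
    · simp only [Pi.add_apply]
      rw [integral_add (integrable_const _) hgi']
      simp only [integral_const, probReal_univ, one_smul]
      linarith [Real.add_one_le_exp (labelProb Q * (momentBound σ σγ / 2))]
  have key := measure_average_ge_le_exp hZ hN (by fun_prop) one_pos (integrable_cov hei) hm t
  simpa only [div_one] using key

/-- Multiplicative Chernoff bound at `θ = 1 / 2`. For a binary label `exp(-R / 2) ≤ 1 - 3 R / 8`,
and `2 (-3/8 + 1/8) = -1/2` produces the threshold. -/
theorem measure_labelFreq_le_half_le (hM : IsOffsetModel Q γ₀) (hZ : IsIIDSample P Z Q)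
    (hN : 0 < N) :
    P.real {ω | labelFreq (fun i => Z i ω) ≤ labelProb Q / 2}
      ≤ Real.exp (-(N * labelProb Q / 8)) := by
  have := hM.prob
  have hN' : (0 : ℝ) < N := by exact_mod_cast hN
  have hR : Integrable (fun z : Obs p => z.1) Q := by
    simpa using hM.integrable_label_mul (integrable_const (1 : ℝ))
  have hhalf : Real.exp (-(1 / 2)) ≤ 5 / 8 := by
    have h1 := Real.quadratic_le_exp_of_nonneg (show (0 : ℝ) ≤ 1 / 2 by norm_num)
    rw [Real.exp_neg, inv_le_comm₀ (Real.exp_pos _) (by norm_num)]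
    linarith
  have hpt : ∀ᵐ z ∂Q, Real.exp (1 / 2 * -z.1) ≤ 1 - 3 / 8 * z.1 := by
    filter_upwards [hM.binary] with z hz
    rcases hz with hz | hz <;> rw [hz]
    · simp
    · rw [mul_neg, mul_one]; linarith
  have hdom : Integrable (fun z : Obs p => 1 - 3 / 8 * z.1) Q :=
    (integrable_const _).sub (hR.const_mul _)
  have hei : Integrable (fun z : Obs p => Real.exp (1 / 2 * -z.1)) Q := by
    refine hdom.mono' (by fun_prop) ?_
    filter_upwards [hpt] with z hz
    rwa [Real.norm_of_nonneg (Real.exp_pos _).le]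
  have hm : ∫ z, Real.exp (1 / 2 * -z.1) ∂Q ≤ Real.exp (-(3 / 8 * labelProb Q)) := by
    refine (integral_mono_ae hei hdom hpt).trans ?_
    rw [integral_sub (integrable_const _) (hR.const_mul _), integral_const_mul, hM.integral_label]
    simp only [integral_const, probReal_univ, one_smul]
    linarith [Real.add_one_le_exp (-(3 / 8 * labelProb Q))]
  have key := measure_average_ge_le_exp hZ hN (f := fun z => -z.1) (by fun_prop)
    (show (0 : ℝ) < 1 / 2 by norm_num) hei hm (N * labelProb Q / 8)
  refine (measureReal_mono fun ω hω => ?_).trans key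
  simp only [Set.mem_ofPred_eq, Finset.sum_neg_distrib, mul_neg, labelFreq] at hω ⊢
  have : N * labelProb Q / 8 / N = labelProb Q / 8 := by field_simp
  rw [this]
  linarith

theorem measure_not_binary (hM : IsOffsetModel Q γ₀) (hZ : IsIIDSample P Z Q) :
    P.real {ω | ¬ ∀ i, (Z i ω).1 = 0 ∨ (Z i ω).1 = 1} = 0 := by
  rw [measureReal_eq_zero_iff, ← ae_iff, ae_all_iff]
  intro i
  have h := hM.binary
  rw [← hZ.2.2 i] at h
  exact ae_of_ae_map (hZ.1 i).aemeasurable h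

theorem labelFreq_le_one {z : Fin N → Obs p} (hz : ∀ i, (z i).1 = 0 ∨ (z i).1 = 1) :
    labelFreq z ≤ 1 := by
  rcases Nat.eq_zero_or_pos N with rfl | hN
  · simp [labelFreq]
  have hN' : (0 : ℝ) < N := by exact_mod_cast hN
  rw [labelFreq, inv_mul_le_iff₀ hN', mul_one]
  calc ∑ i, (z i).1 ≤ ∑ _i : Fin N, (1 : ℝ) :=
        Finset.sum_le_sum fun i _ => by rcases hz i with h | h <;> norm_num [h]
    _ = N := by simp

theorem abs_score_le (z : Fin N → Obs p) {a b : ℝ} (ha : 0 < a) (hb : 0 ≤ b)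
    (γ : Vec (p + 1)) (j : Fin (p + 1)) :
    |score z b γ j| ≤ |score z a γ j| + |b - a| / a *
      ((N : ℝ)⁻¹ * ∑ i, link a (linPred γ (z i).2.2) * |augment (z i).2.2 j|) := by
  have h1 : score z b γ j = score z a γ j + (N : ℝ)⁻¹ *
      ∑ i, (link a (linPred γ (z i).2.2) - link b (linPred γ (z i).2.2)) * augment (z i).2.2 j := by
    rw [score, score, ← mul_add, ← Finset.sum_add_distrib]
    congr 1
    refine Finset.sum_congr rfl fun i _ => ?_
    ring
  rw [h1]
  refine (abs_add_le _ _).trans (add_le_add_right ?_ _)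
  rw [abs_mul, abs_of_nonneg (by positivity : (0 : ℝ) ≤ (N : ℝ)⁻¹), mul_left_comm,
    Finset.mul_sum _ _ (|b - a| / a)]
  refine mul_le_mul_of_nonneg_left ?_ (by positivity)
  refine (Finset.abs_sum_le_sum_abs _ _).trans (Finset.sum_le_sum fun i _ => ?_)
  rw [abs_mul, ← mul_assoc]
  exact mul_le_mul_of_nonneg_right (abs_link_sub_link_le ha hb _) (abs_nonneg _)

/-- The root terms add up to `2 K + 7 K = 9 K`, the linear ones to `2 + 14 / 3`, which is at most
`14 * (4 / 5)`. The factor `√(log (2 N))` enters only through its lower bound `4 / 5`. -/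
theorem score_bound_le_gradBound {π K c : ℝ} (hπ : 0 < π) (hK : 2 ≤ K) (hc : 0 < c) (hN : 0 < N)
    (hcN : 9 * c * Real.log (p + 1) ≤ N * π) :
    2 * √(π * K * ((1 + c) * Real.log (p + 1)) / N) + 2 * ((1 + c) * Real.log (p + 1)) / N
      + 14 * √(π * (c * Real.log (p + 1)) / N) / π
        * (π * (K / 2) + (1 + c) * Real.log (p + 1) / N)
      ≤ (1 + c) * gradBound (9 * K) 14 π N p := by
  have hN' : (0 : ℝ) < N := by exact_mod_cast hN
  set L := Real.log (p + 1) with hL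
  have hL0 : 0 ≤ L := Real.log_nonneg (by linarith [(Nat.cast_nonneg p : (0 : ℝ) ≤ p)])
  set r := √(π * L / N) with hr
  have hr0 : 0 ≤ r := Real.sqrt_nonneg _
  have hrsq : r ^ 2 = π * L / N := Real.sq_sqrt (by positivity)
  have h1 : √(π * K * ((1 + c) * L) / N) ≤ K * (1 + c) * r := by
    refine Real.sqrt_le_iff.2 ⟨by positivity, ?_⟩
    rw [mul_pow, hrsq]
    have : π * K * ((1 + c) * L) / N = (K * (1 + c)) * (π * L / N) := by ring
    rw [this]
    refine mul_le_mul_of_nonneg_right ?_ (by positivity)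
    have : 1 ≤ K * (1 + c) := by nlinarith
    nlinarith
  have h2 : √(π * (c * L) / N) ≤ (1 + c) * r := by
    refine Real.sqrt_le_iff.2 ⟨by positivity, ?_⟩
    rw [mul_pow, hrsq]
    have : π * (c * L) / N = c * (π * L / N) := by ring
    rw [this]
    refine mul_le_mul_of_nonneg_right ?_ (by positivity)
    nlinarith
  have h3 : √(π * (c * L) / N) ≤ 1 / 3 * π := by
    refine Real.sqrt_le_iff.2 ⟨by positivity, ?_⟩
    rw [div_le_iff₀ hN']
    nlinarith
  have h4' : 4 / 5 ≤ √(Real.log (2 * N)) := by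
    refine Real.le_sqrt_of_sq_le ?_
    have h5 : Real.log 2 ≤ Real.log (2 * N) := by
      refine Real.log_le_log (by norm_num) ?_
      have : (1 : ℝ) ≤ N := by exact_mod_cast hN
      linarith
    have := Real.log_two_gt_d9
    norm_num at this ⊢
    linarith
  have h6 : 14 * √(π * (c * L) / N) / π * (π * (K / 2) + (1 + c) * L / N)
      ≤ 7 * K * ((1 + c) * r) + 14 / 3 * ((1 + c) * (L / N)) := by
    have e1 : 14 * √(π * (c * L) / N) / π * (π * (K / 2) + (1 + c) * L / N)
        = 7 * K * √(π * (c * L) / N)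
          + 14 * (√(π * (c * L) / N) / π) * ((1 + c) * (L / N)) := by
      field_simp
      ring
    have e2 : √(π * (c * L) / N) / π ≤ 1 / 3 := by
      rw [div_le_iff₀ hπ]; exact h3
    rw [e1]
    have e3 : 0 ≤ (1 + c) * (L / N) := by positivity
    refine add_le_add (mul_le_mul_of_nonneg_left h2 (by positivity)) ?_
    refine mul_le_mul_of_nonneg_right ?_ e3
    linarith
  have h7 : 4 / 5 * ((1 + c) * (L / N)) ≤ √(Real.log (2 * N)) * ((1 + c) * (L / N)) :=
    mul_le_mul_of_nonneg_right h4' (by positivity)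
  have h8 : 2 * ((1 + c) * L) / N = 2 * ((1 + c) * (L / N)) := by ring
  have h9 : 0 ≤ (1 + c) * (L / N) := by positivity
  have h10 : (1 + c) * gradBound (9 * K) 14 π N p
      = 9 * K * ((1 + c) * r) + 14 * (√(Real.log (2 * N)) * ((1 + c) * (L / N))) := by
    rw [gradBound, ← hL, ← hr]; ring
  rw [h10, h8]
  linarith

/-- Deviations are taken at level `c log (p + 1)` for the label frequency and `(1 + c) log (p + 1)`
per coordinate, the extra logarithm paying for the union over `p + 1` coordinates. -/
theorem exists_good_event (hM : IsOffsetModel Q γ₀) (hZ : IsIIDSample P Z Q)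
    (hσ : 0 < σ) (hσγ : 0 < σγ) (hlin : psi2Norm (covLaw Q) (linPred γ₀) ≤ ENNReal.ofReal σγ)
    (hcov : ∀ j : Fin (p + 1),
      psi2Norm (covLaw Q) (fun x => augment x j) ≤ ENNReal.ofReal σ)
    (hp : 0 < p) {c : ℝ} (hc : 0 < c) (hcN : 9 * c * Real.log (p + 1) < N * labelProb Q) :
    ∃ B : Set Ω, P.real B ≤ 6 * ((p : ℝ) + 1) ^ (-c) ∧ ∀ ω ∉ B,
      labelProb Q / 2 ≤ labelFreq (fun i => Z i ω) ∧ labelFreq (fun i => Z i ω) ≤ 1 ∧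
      |labelFreq (fun i => Z i ω) - labelProb Q|
        ≤ 14 * √(labelProb Q * (c * Real.log (p + 1)) / N) ∧
      ∀ j, |score (fun i => Z i ω) (labelFreq fun i => Z i ω) γ₀ j|
        ≤ (1 + c) * gradBound (9 * momentBound σ σγ) 14 (labelProb Q) N p := by
  have hp' : (0 : ℝ) < p := by exact_mod_cast hp
  have hL : 0 < Real.log (p + 1) := Real.log_pos (by linarith)
  have hN : 0 < N := by
    rcases Nat.eq_zero_or_pos N with rfl | h
    · rw [Nat.cast_zero, zero_mul] at hcN
      have : 0 < 9 * c * Real.log (p + 1) := by positivity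
      linarith
    · exact h
  have hpos := hM.labelProb_pos
  set L := Real.log (p + 1) with hLdef
  set E := Real.exp (-(c * L)) with hE
  have hEp : ((p : ℝ) + 1) ^ (-c) = E := by
    rw [Real.rpow_def_of_pos (by linarith), hE, ← hLdef]
    congr 1; ring
  have hEt : ((p : ℝ) + 1) * Real.exp (-((1 + c) * L)) = E := by
    have : Real.exp L = p + 1 := Real.exp_log (by linarith)
    rw [← this, ← Real.exp_add]
    congr 1; ring
  set A₁ := {ω | 14 * √(labelProb Q * (c * L) / N)
    ≤ |labelFreq (fun i => Z i ω) - labelProb Q|}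
  set A₂ := {ω | labelFreq (fun i => Z i ω) ≤ labelProb Q / 2}
  set A₃ := {ω | ¬ ∀ i, (Z i ω).1 = 0 ∨ (Z i ω).1 = 1}
  set A₄ : Fin (p + 1) → Set Ω := fun j =>
    {ω | 2 * √(labelProb Q * momentBound σ σγ * ((1 + c) * L) / N) + 2 * ((1 + c) * L) / N
      ≤ |score (fun i => Z i ω) (labelProb Q) γ₀ j|}
  set A₅ : Fin (p + 1) → Set Ω := fun j =>
    {ω | labelProb Q * (momentBound σ σγ / 2) + (1 + c) * L / N ≤ (N : ℝ)⁻¹ *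
      ∑ i, link (labelProb Q) (linPred γ₀ (Z i ω).2.2) * |augment (Z i ω).2.2 j|}
  have m1 : P.real A₁ ≤ 2 * E :=
    measure_abs_labelFreq_sub_ge_le hM hZ hN (by positivity) (by linarith)
  have m2 : P.real A₂ ≤ E := (measure_labelFreq_le_half_le hM hZ hN).trans
    (Real.exp_le_exp.2 (by nlinarith [mul_pos hc hL]))
  have m3 : P.real A₃ = 0 := measure_not_binary hM hZ
  have m45 : P.real (⋃ j, (A₄ j ∪ A₅ j)) ≤ 3 * E := by
    refine (measureReal_iUnion_fintype_le _).trans ?_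
    calc ∑ j, P.real (A₄ j ∪ A₅ j) ≤ ∑ _j : Fin (p + 1), 3 * Real.exp (-((1 + c) * L)) := by
          refine Finset.sum_le_sum fun j _ => (measureReal_union_le _ _).trans ?_
          have h4 : P.real (A₄ j) ≤ 2 * Real.exp (-((1 + c) * L)) :=
            measure_abs_score_ge_le hM hZ hN hσ hσγ hlin (hcov j) (by positivity)
          have h5 : P.real (A₅ j) ≤ Real.exp (-((1 + c) * L)) :=
            measure_average_link_mul_abs_ge_le hM hZ hN hσ hσγ hlin (hcov j) _
          linarith
      _ = 3 * E := by
          rw [Finset.sum_const, Finset.card_univ, Fintype.card_fin, nsmul_eq_mul, ← hEt]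
          push_cast
          ring
  -- The budget is `6 = 2 + 1 + 0 + 3`.
  refine ⟨A₁ ∪ A₂ ∪ A₃ ∪ ⋃ j, (A₄ j ∪ A₅ j), ?_, ?_⟩
  · rw [hEp]
    have h1 := measureReal_union_le (μ := P) (A₁ ∪ A₂ ∪ A₃) (⋃ j, (A₄ j ∪ A₅ j))
    have h2 := measureReal_union_le (μ := P) (A₁ ∪ A₂) A₃
    have h3 := measureReal_union_le (μ := P) A₁ A₂
    linarith
  · intro ω hω
    simp only [A₁, A₂, A₃, A₄, A₅, Set.mem_union, Set.mem_iUnion, Set.mem_ofPred_eq, not_or,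
      not_exists, not_le, not_not] at hω
    obtain ⟨⟨⟨h1, h2⟩, h3⟩, h45⟩ := hω
    refine ⟨h2.le, labelFreq_le_one h3, h1.le, fun j => ?_⟩
    have h4 := (h45 j).1.le
    have h5 := (h45 j).2.le
    refine le_trans ?_ (score_bound_le_gradBound hpos (two_le_momentBound σ σγ) hc hN hcN.le)
    refine (abs_score_le _ hpos (by linarith) γ₀ j).trans (add_le_add h4 ?_)
    refine mul_le_mul (by gcongr) h5 ?_ (by positivity)
    exact mul_nonneg (by positivity) (Finset.sum_nonneg fun i _ =>
      mul_nonneg (link_nonneg hpos.le _) (abs_nonneg _))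

/-- The finite-sample bound for every minimizer. -/
theorem measure_norm_sub_gt_le (hM : IsOffsetModel Q γ₀) (hZ : IsIIDSample P Z Q)
    (hσ : 0 < σ) (hσγ : 0 < σγ) (hlin : psi2Norm (covLaw Q) (linPred γ₀) ≤ ENNReal.ofReal σγ)
    (hcov : ∀ j : Fin (p + 1),
      psi2Norm (covLaw Q) (fun x => augment x j) ≤ ENNReal.ofReal σ)
    {κ α : ℝ} (hκ : 0 < κ)
    (hrsc : P.real {ω | ¬ RSC (fun i => Z i ω) 1 γ₀ κ (coneBall (support γ₀))} ≤ α)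
    {c lam : ℝ} (hc : 0 < c)
    (hlam : 2 * (1 + c) * gradBound (9 * momentBound σ σγ) 14 (labelProb Q) N p ≤ lam)
    (hlamle : lam ≤ κ * labelProb Q / (9 * √(sparsity γ₀)))
    (hcN : 9 * c * Real.log (p + 1) < N * labelProb Q) :
    P.real {ω | ∃ γhat, IsL1Estimator (fun i => Z i ω) lam γhat ∧
      9 * lam * √(sparsity γ₀) / (labelProb Q * κ) < ‖γhat - γ₀‖}
      ≤ 8 * ((p : ℝ) + 1) ^ (-c) + α := by
  have hα : 0 ≤ α := measureReal_nonneg.trans hrsc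
  have hpos := hM.labelProb_pos
  -- For `p = 0` the logarithm vanishes, but the right side is at least `8`.
  rcases Nat.eq_zero_or_pos p with rfl | hp
  · refine measureReal_le_one.trans ?_
    norm_num
    linarith
  obtain ⟨B, hB, hgood⟩ := exists_good_event hM hZ hσ hσγ hlin hcov hp hc hcN
  have hp' : (0 : ℝ) < p := by exact_mod_cast hp
  have hL : 0 < Real.log ((p : ℝ) + 1) := Real.log_pos (by linarith)
  have hN' : (0 : ℝ) < N := by
    have : 0 < 9 * c * Real.log ((p : ℝ) + 1) := by positivity
    exact pos_of_mul_pos_left (this.trans hcN) hpos.le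
  have hlam0 : 0 < lam := by
    refine lt_of_lt_of_le ?_ hlam
    have := two_le_momentBound σ σγ
    have : 0 < √(labelProb Q * Real.log ((p : ℝ) + 1) / N) := Real.sqrt_pos.2 (by positivity)
    unfold gradBound
    positivity
  refine (measureReal_mono (s₂ := B ∪ _) ?_).trans
    ((measureReal_union_le _ _).trans (add_le_add (hB.trans ?_) hrsc))
  · rintro ω ⟨γhat, hγ, hlt⟩
    by_contra hcon
    simp only [Set.mem_union, not_or, Set.mem_ofPred_eq, not_not] at hcon
    obtain ⟨h1, h2, -, h4⟩ := hgood ω hcon.1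
    refine absurd hlt (not_lt.2 ?_)
    exact norm_sub_le_of_isL1Estimator hκ hpos hlam0 hlamle h1 h2
      (fun j => (h4 j).trans (by linarith)) hcon.2 hγ
  · have : 0 ≤ ((p : ℝ) + 1) ^ (-c) := by positivity
    linarith

end GoodEvent

/-! ### Moments of inverse propensity scores -/

section Moments

variable {α : Type*} [MeasurableSpace α] {μ : Measure α} {W : α → ℝ} {s : ℝ}

/-- Domination by a single exponential avoids the triangle inequality, which fails for `r < 1`. -/
theorem eLpNorm'_le_of_abs_le_exp (hs : 0 < s) (h : psi2Norm μ W ≤ ENNReal.ofReal s) {f : α → ℝ}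
    {A k r : ℝ} (hA : 0 ≤ A) (hr : 0 < r) (hf : ∀ x, |f x| ≤ A * Real.exp (k * |W x|)) :
    eLpNorm' f r μ ≤ ENNReal.ofReal (A * (2 * Real.exp ((r * k) ^ 2 * s ^ 2)) ^ (1 / r)) := by
  rw [eLpNorm'_eq_lintegral_enorm]
  have hpt : ∀ x, ‖f x‖ₑ ^ r
      ≤ ENNReal.ofReal (A ^ r) * ENNReal.ofReal (Real.exp (r * k * |W x|)) := by
    intro x
    rw [← ofReal_norm, Real.norm_eq_abs, ENNReal.ofReal_rpow_of_nonneg (abs_nonneg _) hr.le,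
      ← ENNReal.ofReal_mul (by positivity)]
    refine ENNReal.ofReal_le_ofReal ?_
    refine (Real.rpow_le_rpow (abs_nonneg _) (hf x) hr.le).trans_eq ?_
    rw [Real.mul_rpow hA (Real.exp_pos _).le, ← Real.exp_mul]
    congr 2
    ring
  have h1 : ∫⁻ x, ‖f x‖ₑ ^ r ∂μ
      ≤ ENNReal.ofReal (A ^ r * (2 * Real.exp ((r * k) ^ 2 * s ^ 2))) := by
    refine (lintegral_mono hpt).trans ?_
    rw [lintegral_const_mul' _ _ ENNReal.ofReal_ne_top, ENNReal.ofReal_mul (by positivity)]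
    gcongr
    exact lintegral_exp_mul_abs_le hs h (r * k)
  refine (ENNReal.rpow_le_rpow h1 (by positivity)).trans_eq ?_
  rw [ENNReal.ofReal_rpow_of_nonneg (by positivity) (by positivity),
    Real.mul_rpow (by positivity) (by positivity), ← Real.rpow_mul hA, mul_one_div_cancel hr.ne',
    Real.rpow_one]

theorem inv_le_integral_exp_neg_mul_abs [IsProbabilityMeasure μ] (hs : 0 < s) (hW : Measurable W)
    (h : psi2Norm μ W ≤ ENNReal.ofReal s) {k : ℝ} (hk : 0 ≤ k) :
    (2 * Real.exp (k ^ 2 * s ^ 2))⁻¹ ≤ ∫ x, Real.exp (-(k * |W x|)) ∂μ := by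
  set K := 2 * Real.exp (k ^ 2 * s ^ 2) with hK
  have hKpos : 0 < K := by positivity
  have hi := integrable_exp_mul_abs hs hW h k
  have hb := integral_exp_mul_abs_le hs hW h k
  have hin : Integrable (fun x => Real.exp (-(k * |W x|))) μ := by
    refine (integrable_const (1 : ℝ)).mono' (by fun_prop) (ae_of_all _ fun x => ?_)
    rw [Real.norm_of_nonneg (Real.exp_pos _).le, Real.exp_le_one_iff, neg_nonpos]
    positivity
  -- Tangent to the convex function `e ↦ e⁻¹` at `e = K`; integrating it is Jensen's inequality in
  -- explicit form.
  have hpt : ∀ x, 2 * K⁻¹ - K⁻¹ ^ 2 * Real.exp (k * |W x|) ≤ Real.exp (-(k * |W x|)) := by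
    intro x
    set e := Real.exp (k * |W x|) with he
    have hepos : 0 < e := Real.exp_pos _
    rw [Real.exp_neg, ← he]
    have h1 : e⁻¹ - (2 * K⁻¹ - K⁻¹ ^ 2 * e) = e⁻¹ * (1 - K⁻¹ * e) ^ 2 := by
      field_simp
      ring
    have : 0 ≤ e⁻¹ * (1 - K⁻¹ * e) ^ 2 := by positivity
    linarith
  have h2 := integral_mono ((integrable_const _).sub (hi.const_mul _)) hin hpt
  simp only [Pi.sub_apply] at h2
  rw [integral_sub (integrable_const _) (hi.const_mul _), integral_const_mul (K⁻¹ ^ 2)] at h2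
  simp only [integral_const, probReal_univ, one_smul] at h2
  have h3 : K⁻¹ ^ 2 * ∫ x, Real.exp (k * |W x|) ∂μ ≤ K⁻¹ := by
    calc _ ≤ K⁻¹ ^ 2 * K := by gcongr
      _ = K⁻¹ := by field_simp
  linarith

end Moments

section Law

variable {p : ℕ} {Q : Measure (Obs p)} {γ₀ : Vec (p + 1)} {σ σγ : ℝ}

theorem IsOffsetModel.inv_truePS (hM : IsOffsetModel Q γ₀) (x : Vec p) :
    (truePS Q γ₀ x)⁻¹ = 1 + (labelProb Q)⁻¹ * Real.exp (-linPred γ₀ x) :=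
  inv_link hM.labelProb_pos _

@[fun_prop]
theorem measurable_offsetPS (a : ℝ) (γ : Vec (p + 1)) : Measurable (offsetPS a γ : Vec p → ℝ) := by
  have : (offsetPS a γ : Vec p → ℝ) = fun x => link a (linPred γ x) := rfl
  rw [this]
  fun_prop

theorem IsOffsetModel.le_inv_truePS (hM : IsOffsetModel Q γ₀) (x : Vec p) :
    (labelProb Q)⁻¹ * Real.exp (-|linPred γ₀ x|) ≤ (truePS Q γ₀ x)⁻¹ := by
  have hpos := hM.labelProb_pos
  rw [hM.inv_truePS]
  have : Real.exp (-|linPred γ₀ x|) ≤ Real.exp (-linPred γ₀ x) :=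
    Real.exp_le_exp.2 (neg_le_neg (le_abs_self _))
  have h2 : (labelProb Q)⁻¹ * Real.exp (-|linPred γ₀ x|)
      ≤ (labelProb Q)⁻¹ * Real.exp (-linPred γ₀ x) := by gcongr
  linarith

theorem IsOffsetModel.inv_truePS_le (hM : IsOffsetModel Q γ₀) (x : Vec p) :
    (truePS Q γ₀ x)⁻¹ ≤ 2 * (labelProb Q)⁻¹ * Real.exp |linPred γ₀ x| := by
  have hpos := hM.labelProb_pos
  rw [hM.inv_truePS]
  have h1 : Real.exp (-linPred γ₀ x) ≤ Real.exp |linPred γ₀ x| :=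
    Real.exp_le_exp.2 (neg_le_abs _)
  have h2 : (labelProb Q)⁻¹ * Real.exp (-linPred γ₀ x)
      ≤ (labelProb Q)⁻¹ * Real.exp |linPred γ₀ x| := by gcongr
  have h3 : 1 ≤ (labelProb Q)⁻¹ * Real.exp |linPred γ₀ x| :=
    one_le_mul_of_one_le_of_one_le ((one_le_inv₀ hpos).2 hM.labelProb_le_one)
      (Real.one_le_exp (abs_nonneg _))
  linarith

theorem IsOffsetModel.truePS_pos (hM : IsOffsetModel Q γ₀) (x : Vec p) : 0 < truePS Q γ₀ x := by
  have hpos := hM.labelProb_pos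
  unfold truePS offsetPS
  positivity

theorem IsOffsetModel.eLpNorm'_inv_truePS_le (hM : IsOffsetModel Q γ₀) (hσγ : 0 < σγ)
    (hlin : psi2Norm (covLaw Q) (linPred γ₀) ≤ ENNReal.ofReal σγ) {r : ℝ} (hr : 0 < r) :
    eLpNorm' (fun x => (truePS Q γ₀ x)⁻¹) r (covLaw Q) ≤
      ENNReal.ofReal (2 * (labelProb Q)⁻¹ * (2 * Real.exp (r ^ 2 * σγ ^ 2)) ^ (1 / r)) := by
  have hpos := hM.labelProb_pos
  have := eLpNorm'_le_of_abs_le_exp hσγ hlin (f := fun x => (truePS Q γ₀ x)⁻¹) (k := 1)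
    (A := 2 * (labelProb Q)⁻¹) (by positivity) hr fun x => by
      rw [abs_of_pos (inv_pos.2 (hM.truePS_pos x)), one_mul]
      exact hM.inv_truePS_le x
  rwa [mul_one] at this

theorem IsOffsetModel.le_eLpNorm'_inv_truePS (hM : IsOffsetModel Q γ₀) (hσγ : 0 < σγ)
    (hlin : psi2Norm (covLaw Q) (linPred γ₀) ≤ ENNReal.ofReal σγ) {r : ℝ} (hr : 0 < r) :
    ENNReal.ofReal ((labelProb Q)⁻¹ * ((2 * Real.exp (r ^ 2 * σγ ^ 2))⁻¹) ^ (1 / r))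
      ≤ eLpNorm' (fun x => (truePS Q γ₀ x)⁻¹) r (covLaw Q) := by
  have := hM.isProbabilityMeasure_covLaw
  have hpos := hM.labelProb_pos
  have hb := inv_le_integral_exp_neg_mul_abs hσγ (measurable_linPred γ₀) hlin hr.le
  have hin : Integrable (fun x => Real.exp (-(r * |linPred γ₀ x|))) (covLaw Q) := by
    refine (integrable_const (1 : ℝ)).mono' (by fun_prop) (ae_of_all _ fun x => ?_)
    rw [Real.norm_of_nonneg (Real.exp_pos _).le, Real.exp_le_one_iff, neg_nonpos]
    positivity
  rw [eLpNorm'_eq_lintegral_enorm]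
  have hpt : ∀ x : Vec p, ENNReal.ofReal ((labelProb Q)⁻¹ ^ r)
      * ENNReal.ofReal (Real.exp (-(r * |linPred γ₀ x|))) ≤ ‖(truePS Q γ₀ x)⁻¹‖ₑ ^ r := by
    intro x
    rw [← ofReal_norm, Real.norm_of_nonneg (inv_pos.2 (hM.truePS_pos x)).le,
      ENNReal.ofReal_rpow_of_nonneg (inv_pos.2 (hM.truePS_pos x)).le hr.le,
      ← ENNReal.ofReal_mul (by positivity)]
    refine ENNReal.ofReal_le_ofReal ?_
    refine Eq.trans_le ?_ (Real.rpow_le_rpow (by positivity) (hM.le_inv_truePS x) hr.le)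
    rw [Real.mul_rpow (by positivity) (Real.exp_pos _).le, ← Real.exp_mul]
    congr 2
    ring
  have h1 : ENNReal.ofReal ((labelProb Q)⁻¹ ^ r * (2 * Real.exp (r ^ 2 * σγ ^ 2))⁻¹)
      ≤ ∫⁻ x, ‖(truePS Q γ₀ x)⁻¹‖ₑ ^ r ∂(covLaw Q) := by
    refine le_trans ?_ (lintegral_mono hpt)
    rw [lintegral_const_mul' _ _ ENNReal.ofReal_ne_top, ENNReal.ofReal_mul (by positivity),
      ← ofReal_integral_eq_lintegral_ofReal hin (ae_of_all _ fun x => (Real.exp_pos _).le)]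
    gcongr
  refine Eq.trans_le ?_ (ENNReal.rpow_le_rpow h1 (by positivity : 0 ≤ 1 / r))
  rw [ENNReal.ofReal_rpow_of_nonneg (by positivity) (by positivity),
    Real.mul_rpow (by positivity) (by positivity), ← Real.rpow_mul (by positivity),
    mul_one_div_cancel hr.ne', Real.rpow_one]

theorem IsOffsetModel.integral_inv_truePS_mem (hM : IsOffsetModel Q γ₀) (hσγ : 0 < σγ)
    (hlin : psi2Norm (covLaw Q) (linPred γ₀) ≤ ENNReal.ofReal σγ) :
    (labelProb Q)⁻¹ * (2 * Real.exp (σγ ^ 2))⁻¹ ≤ ∫ x, (truePS Q γ₀ x)⁻¹ ∂(covLaw Q) ∧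
    ∫ x, (truePS Q γ₀ x)⁻¹ ∂(covLaw Q) ≤ 2 * (labelProb Q)⁻¹ * (2 * Real.exp (σγ ^ 2)) := by
  have hpos := hM.labelProb_pos
  have h1 := hM.eLpNorm'_inv_truePS_le hσγ hlin one_pos
  have h2 := hM.le_eLpNorm'_inv_truePS hσγ hlin one_pos
  have h3 : eLpNorm' (fun x => (truePS Q γ₀ x)⁻¹) 1 (covLaw Q)
      = ∫⁻ x, ENNReal.ofReal (truePS Q γ₀ x)⁻¹ ∂(covLaw Q) := by
    rw [eLpNorm'_eq_lintegral_enorm]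
    simp only [ENNReal.rpow_one, div_one]
    refine lintegral_congr fun x => ?_
    rw [← ofReal_norm, Real.norm_of_nonneg (inv_pos.2 (hM.truePS_pos x)).le]
  rw [h3] at h1 h2
  have hmeas : Measurable (fun x : Vec p => (truePS Q γ₀ x)⁻¹) := by
    unfold truePS
    fun_prop
  have h0 : ∀ x : Vec p, 0 ≤ (truePS Q γ₀ x)⁻¹ := fun x => (inv_pos.2 (hM.truePS_pos x)).le
  have hint : Integrable (fun x => (truePS Q γ₀ x)⁻¹) (covLaw Q) := by
    refine ⟨hmeas.aestronglyMeasurable, ?_⟩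
    rw [hasFiniteIntegral_iff_ofReal (ae_of_all _ h0)]
    exact h1.trans_lt ENNReal.ofReal_lt_top
  rw [← ofReal_integral_eq_lintegral_ofReal hint (ae_of_all _ h0)] at h1 h2
  rw [ENNReal.ofReal_le_ofReal_iff (by positivity)] at h1
  rw [ENNReal.ofReal_le_ofReal_iff (integral_nonneg h0)] at h2
  simp only [one_pow, one_mul, div_one, Real.rpow_one] at h1 h2
  exact ⟨h2, h1⟩

theorem IsOffsetModel.effRate_mem (hM : IsOffsetModel Q γ₀) (hσγ : 0 < σγ)
    (hlin : psi2Norm (covLaw Q) (linPred γ₀) ≤ ENNReal.ofReal σγ) :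
    (4 * Real.exp (σγ ^ 2))⁻¹ * labelProb Q ≤ effRate Q γ₀ ∧
    effRate Q γ₀ ≤ 2 * Real.exp (σγ ^ 2) * labelProb Q := by
  have hpos := hM.labelProb_pos
  obtain ⟨h1, h2⟩ := hM.integral_inv_truePS_mem hσγ hlin
  have hI : 0 < ∫ x, (truePS Q γ₀ x)⁻¹ ∂(covLaw Q) := lt_of_lt_of_le (by positivity) h1
  unfold effRate
  constructor
  · refine Eq.trans_le ?_ (inv_anti₀ hI h2)
    field_simp
    norm_num
  · refine (inv_anti₀ (by positivity) h1).trans_eq ?_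
    field_simp

/-- The norm in `L^r` dominates the weighted mean squared error for every `r > 2`. -/
theorem IsOffsetModel.weightedMSE_le (hM : IsOffsetModel Q γ₀) (hσγ : 0 < σγ)
    (hlin : psi2Norm (covLaw Q) (linPred γ₀) ≤ ENNReal.ofReal σγ) {r q : ℝ} (hr : 0 < r)
    (hqr : q.HolderConjugate (r / 2)) {h : Vec p → ℝ} (hh : Measurable h) :
    weightedMSE Q γ₀ h ≤ ENNReal.ofReal (4 * Real.exp (σγ ^ 2)
      * (2 * Real.exp (q ^ 2 * σγ ^ 2)) ^ (1 / q)) * eLpNorm' h r (covLaw Q) ^ (2 : ℝ) := by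
  have hpos := hM.labelProb_pos
  obtain ⟨-, hrate⟩ := hM.effRate_mem hσγ hlin
  -- The rate is `O(π)` and the inverse propensity is `O(π⁻¹)` up to an exponential, so `π` cancels
  -- and the weight has moments bounded independently of the law.
  have hw : ∀ x : Vec p, effRate Q γ₀ / truePS Q γ₀ x
      ≤ 4 * Real.exp (σγ ^ 2) * Real.exp |linPred γ₀ x| := by
    intro x
    rw [div_eq_mul_inv]
    refine (mul_le_mul hrate (hM.inv_truePS_le x) (inv_pos.2 (hM.truePS_pos x)).le
      (by positivity)).trans_eq ?_
    field_simp
    norm_num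
  have hpt : ∀ x : Vec p, ENNReal.ofReal (effRate Q γ₀ / truePS Q γ₀ x * h x ^ 2)
      ≤ ((fun x => ‖4 * Real.exp (σγ ^ 2) * Real.exp |linPred γ₀ x|‖ₑ)
        * fun x => ‖h x‖ₑ ^ (2 : ℝ)) x := by
    intro x
    rw [Pi.mul_apply, ← ofReal_norm, ← ofReal_norm,
      Real.norm_of_nonneg (by positivity), Real.norm_eq_abs,
      ENNReal.ofReal_rpow_of_nonneg (abs_nonneg _) (by norm_num), ← ENNReal.ofReal_mul
      (by positivity), Real.rpow_two, sq_abs]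
    exact ENNReal.ofReal_le_ofReal (mul_le_mul_of_nonneg_right (hw x) (sq_nonneg _))
  refine (lintegral_mono hpt).trans ?_
  refine (ENNReal.lintegral_mul_le_Lp_mul_Lq _ hqr (by fun_prop) (by fun_prop)).trans ?_
  refine mul_le_mul' ?_ (le_of_eq ?_)
  · have := eLpNorm'_le_of_abs_le_exp hσγ hlin
      (f := fun x => 4 * Real.exp (σγ ^ 2) * Real.exp |linPred γ₀ x|) (k := 1)
      (A := 4 * Real.exp (σγ ^ 2)) (by positivity) hqr.pos fun x => by
        rw [abs_of_pos (by positivity), one_mul]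
    rwa [mul_one, eLpNorm'_eq_lintegral_enorm] at this
  · rw [eLpNorm'_eq_lintegral_enorm, ← ENNReal.rpow_mul]
    congr 1
    · refine lintegral_congr fun x => ?_
      rw [← ENNReal.rpow_mul]
      congr 1
      ring
    · field_simp

/-! ### Propensity score ratios -/

theorem abs_one_sub_exp_neg_le (w : ℝ) : |1 - Real.exp (-w)| ≤ |w| * Real.exp |w| := by
  rw [abs_le]
  have h1 := Real.add_one_le_exp (-w)
  have h2 : 1 ≤ Real.exp |w| := Real.one_le_exp (abs_nonneg _)
  have h3 : Real.exp (-w) ≤ Real.exp |w| := Real.exp_le_exp.2 (neg_le_abs w)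
  have h4 := exp_le_one_add_mul_exp (-w)
  constructor
  · have : -w * Real.exp (-w) ≤ |w| * Real.exp |w| := by
      refine (mul_le_mul_of_nonneg_right (neg_le_abs w) (Real.exp_pos _).le).trans ?_
      gcongr
    linarith
  · have : |w| ≤ |w| * Real.exp |w| := le_mul_of_one_le_right (abs_nonneg _) h2
    linarith [le_abs_self w]

/-- The deviation equals `(1 + a eᵘ)⁻¹ (1 - (a / b) e⁻ʷ)`. The first factor is at most one, so the
bound does not depend on `u`. -/
theorem abs_one_sub_link_div_le {a b : ℝ} (ha : 0 < a) (hb : a / 2 ≤ b) (u w : ℝ) :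
    |1 - link a u / link b (u + w)| ≤ 2 * |b - a| / a + 2 * (|w| * Real.exp |w|) := by
  have hb0 : 0 < b := by linarith
  have h1 : 1 - link a u / link b (u + w)
      = link a u * Real.exp (-u) * a⁻¹ * (1 - a / b * Real.exp (-w)) := by
    rw [div_eq_mul_inv, inv_link hb0, neg_add, Real.exp_add]
    have h2 : link a u * (1 + a⁻¹ * Real.exp (-u)) = 1 := by
      rw [← inv_link ha]
      refine mul_inv_cancel₀ (ne_of_gt ?_)
      unfold link
      positivity
    have h3 : link a u * Real.exp (-u) * a⁻¹ * (1 - a / b * Real.exp (-w))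
        = link a u * (a⁻¹ * Real.exp (-u)) - link a u * (b⁻¹ * (Real.exp (-u) * Real.exp (-w))) := by
      field_simp
    rw [h3]
    linarith
  have h4 : 0 ≤ link a u * Real.exp (-u) * a⁻¹ :=
    mul_nonneg (mul_nonneg (link_nonneg ha.le u) (Real.exp_pos _).le) (inv_pos.2 ha).le
  have h5 : link a u * Real.exp (-u) * a⁻¹ ≤ 1 := by
    have h6 := mul_le_mul_of_nonneg_right (link_le_mul_exp ha.le u)
      (show 0 ≤ Real.exp (-u) * a⁻¹ by positivity)
    refine (mul_assoc _ _ _).trans_le (h6.trans_eq ?_)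
    rw [Real.exp_neg]
    field_simp
  rw [h1, abs_mul, abs_of_nonneg h4]
  refine (mul_le_of_le_one_left (abs_nonneg _) h5).trans ?_
  have h7 : 1 - a / b * Real.exp (-w) = (b - a) / b + a / b * (1 - Real.exp (-w)) := by
    field_simp
    ring
  rw [h7]
  refine (abs_add_le _ _).trans (add_le_add ?_ ?_)
  · rw [abs_div, abs_of_pos hb0, div_le_div_iff₀ hb0 ha]
    nlinarith [abs_nonneg (b - a)]
  · rw [abs_mul, abs_of_pos (by positivity)]
    refine mul_le_mul ?_ (abs_one_sub_exp_neg_le w) (abs_nonneg _) (by norm_num)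
    rw [div_le_iff₀ hb0]
    linarith

/-- A unit direction is supplied even for `Δ = 0`, so that the sub-Gaussian scale `σ ‖v‖` stays
positive. -/
theorem exists_unit_smul {n : ℕ} (Δ : Vec (n + 1)) : ∃ v : Vec (n + 1), ‖v‖ = 1 ∧ Δ = ‖Δ‖ • v := by
  rcases eq_or_ne Δ 0 with rfl | h
  · exact ⟨EuclideanSpace.single 0 1, by simp, by simp⟩
  · have : ‖Δ‖ ≠ 0 := norm_ne_zero_iff.2 h
    exact ⟨‖Δ‖⁻¹ • Δ, by rw [norm_smul, norm_inv, norm_norm, inv_mul_cancel₀ this],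
      by rw [smul_smul, mul_inv_cancel₀ this, one_smul]⟩

theorem IsOffsetModel.eLpNorm'_one_sub_truePS_div_le (hM : IsOffsetModel Q γ₀) (hσ : 0 < σ)
    (hsub : ∀ v : Vec (p + 1), psi2Norm (covLaw Q) (linPred v) ≤ ENNReal.ofReal (σ * ‖v‖))
    {b : ℝ} (hb : labelProb Q / 2 ≤ b) {γ : Vec (p + 1)} (hγ : ‖γ - γ₀‖ ≤ 1) {r : ℝ} (hr : 0 < r) :
    eLpNorm' (fun x => 1 - truePS Q γ₀ x / offsetPS b γ x) r (covLaw Q)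
      ≤ ENNReal.ofReal ((2 * |b - labelProb Q| / labelProb Q + 2 * ‖γ - γ₀‖)
        * (2 * Real.exp ((r * 2) ^ 2 * σ ^ 2)) ^ (1 / r)) := by
  have hpos := hM.labelProb_pos
  obtain ⟨v, hv, hΔ⟩ := exists_unit_smul (γ - γ₀)
  have hsv := hsub v
  rw [hv, mul_one] at hsv
  refine eLpNorm'_le_of_abs_le_exp hσ hsv (by positivity) hr fun x => ?_
  have h1 : linPred γ x = linPred γ₀ x + ‖γ - γ₀‖ * linPred v x := by
    rw [← linPred_smul, ← hΔ, ← linPred_add, add_sub_cancel]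
  have h2 := abs_one_sub_link_div_le hpos hb (linPred γ₀ x) (‖γ - γ₀‖ * linPred v x)
  rw [← h1] at h2
  refine le_trans h2 ?_
  set y := |linPred v x| with hy
  have hy0 : 0 ≤ y := abs_nonneg _
  set d := ‖γ - γ₀‖ with hd
  have hd0 : 0 ≤ d := norm_nonneg _
  rw [abs_mul, ← hy, abs_of_nonneg hd0]
  have h3 : 1 ≤ Real.exp (2 * y) := Real.one_le_exp (by positivity)
  -- Here `d ≤ 1` matters: the exponent stays free of the estimation error, which remains only as a
  -- linear factor.
  have h4 : y * Real.exp (d * y) ≤ Real.exp (2 * y) := by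
    rw [two_mul, Real.exp_add]
    refine mul_le_mul (by linarith [Real.add_one_le_exp y]) (Real.exp_le_exp.2 ?_)
      (Real.exp_pos _).le (Real.exp_pos _).le
    exact mul_le_of_le_one_left hy0 hγ
  rw [add_mul]
  refine add_le_add (le_mul_of_one_le_right (by positivity) h3) ?_
  rw [mul_assoc d, mul_assoc 2 d]
  gcongr

end Law

/-! ### Stochastic order symbols -/

section Stochastic

variable {Ω : ℕ → Type*} [∀ N, MeasurableSpace (Ω N)] {P : ∀ N, Measure (Ω N)}
  {B : ∀ N, Set (Ω N)} {W : ∀ N, Ω N → ℝ≥0∞}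

/-- One constant `M` serves every `ε`, since the exceptional sets have vanishing probability. -/
theorem IsBigOP.of_eventually_le (hB : Tendsto (fun N => P N (B N)) atTop (𝓝 0)) {r : ℕ → ℝ}
    {M : ℝ} (hM : 0 < M)
    (hW : ∀ᶠ N in atTop, ∀ ω ∉ B N, W N ω ≤ ENNReal.ofReal (M * r N)) : IsBigOP P W r := by
  intro ε hε
  have h1 : ∀ᶠ N in atTop, P N (B N) ≤ ENNReal.ofReal ε :=
    hB.eventually (ge_mem_nhds (ENNReal.ofReal_pos.2 hε))
  obtain ⟨N₀, hN₀⟩ := eventually_atTop.1 (h1.and hW)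
  refine ⟨M, hM, N₀, fun N hN => (measure_mono fun ω hω => ?_).trans (hN₀ N hN).1⟩
  by_contra hcon
  exact absurd ((hN₀ N hN).2 ω hcon) (not_le.2 hω)

theorem IsLittleOPOne.of_eventually_le (hB : Tendsto (fun N => P N (B N)) atTop (𝓝 0))
    {r : ℕ → ℝ} (hr : Tendsto r atTop (𝓝 0))
    (hW : ∀ᶠ N in atTop, ∀ ω ∉ B N, W N ω ≤ ENNReal.ofReal (r N)) : IsLittleOPOne P W := by
  intro ε hε
  refine tendsto_of_tendsto_of_tendsto_of_le_of_le' tendsto_const_nhds hB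
    (Eventually.of_forall fun N => zero_le) ?_
  filter_upwards [hW, hr.eventually (ge_mem_nhds hε)] with N h1 h2
  refine measure_mono fun ω hω => ?_
  by_contra hcon
  exact absurd ((h1 ω hcon).trans (ENNReal.ofReal_le_ofReal h2)) (not_le.2 hω)

theorem IsLittleOPOne.of_le_mul_rpow_two {V : ∀ N, Ω N → ℝ≥0∞} (hV : IsLittleOPOne P V) {K : ℝ}
    (hK : 0 < K) (hW : ∀ N ω, W N ω ≤ ENNReal.ofReal K * V N ω ^ (2 : ℝ)) :
    IsLittleOPOne P W := by
  intro ε hε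
  refine tendsto_of_tendsto_of_tendsto_of_le_of_le tendsto_const_nhds
    (hV (√(ε / K)) (Real.sqrt_pos.2 (by positivity))) (fun N => zero_le) fun N => ?_
  refine measure_mono fun ω hω => ?_
  by_contra hcon
  simp only [Set.mem_ofPred_eq, not_lt] at hω hcon
  refine absurd ((hW N ω).trans ?_) (not_le.2 hω)
  calc ENNReal.ofReal K * V N ω ^ (2 : ℝ)
      ≤ ENNReal.ofReal K * ENNReal.ofReal (√(ε / K)) ^ (2 : ℝ) := by gcongr
    _ = ENNReal.ofReal ε := by
        rw [ENNReal.ofReal_rpow_of_nonneg (Real.sqrt_nonneg _) (by norm_num), Real.rpow_two,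
          Real.sq_sqrt (by positivity), ← ENNReal.ofReal_mul hK.le, mul_div_cancel₀ _ hK.ne']

end Stochastic

/-! ### Rates -/

section Rates

variable {p s : ℕ → ℕ} {π : ℕ → ℝ}

theorem log_add_one_le_two_mul_log {n : ℕ} (hn : 2 ≤ n) :
    Real.log ((n : ℝ) + 1) ≤ 2 * Real.log n := by
  have hn' : (2 : ℝ) ≤ n := by exact_mod_cast hn
  have h1 : 2 * Real.log n = Real.log ((n : ℝ) ^ 2) := by rw [Real.log_pow]; norm_num
  rw [h1]
  exact Real.log_le_log (by linarith) (by nlinarith)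

theorem eventually_mul_log_add_one_lt (hp : Tendsto p atTop atTop) (hπ : ∀ N, 0 < π N)
    (hs : ∀ N, 0 < s N)
    (hlo : (fun N => (s N : ℝ) * Real.log (p N)) =o[atTop] (fun N => N * π N))
    (c : ℝ) (hc : 0 < c) :
    ∀ᶠ N : ℕ in atTop, c * Real.log ((p N : ℝ) + 1) < N * π N := by
  have h := hlo.def (show 0 < 1 / (4 * c) by positivity)
  filter_upwards [h, hp.eventually_ge_atTop 2, eventually_gt_atTop 0] with N h1 h2 h3
  have hN : (0 : ℝ) < N := by exact_mod_cast h3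
  have hx : 0 < N * π N := mul_pos hN (hπ N)
  have hs1 : (1 : ℝ) ≤ s N := by exact_mod_cast hs N
  have hp1 : (1 : ℝ) ≤ p N := by exact_mod_cast (by omega : 1 ≤ p N)
  have hlog : 0 ≤ Real.log (p N) := Real.log_nonneg hp1
  rw [Real.norm_of_nonneg (by positivity), Real.norm_of_nonneg hx.le] at h1
  have h4 := log_add_one_le_two_mul_log h2
  have h5 : Real.log (p N) ≤ s N * Real.log (p N) := le_mul_of_one_le_left hlog hs1
  have h6 : c * Real.log (p N) ≤ c * (1 / (4 * c) * (N * π N)) :=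
    mul_le_mul_of_nonneg_left (h5.trans h1) hc.le
  have h7 : c * (1 / (4 * c) * (N * π N)) = N * π N / 4 := by field_simp
  nlinarith

/-- The condition `log p log N = O(N π)` is what makes the linear Bernstein term no larger in order
than the root term: compare their squares. -/
theorem exists_eventually_gradBound_le (hp : Tendsto p atTop atTop) (hπ : ∀ N, 0 < π N)
    (hO : (fun N : ℕ => Real.log (p N) * Real.log N) =O[atTop] (fun N => N * π N))
    {C₅ C₆ : ℝ} (h5 : 0 < C₅) (h6 : 0 < C₆) :
    ∃ A > 0, ∀ᶠ N : ℕ in atTop,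
      gradBound C₅ C₆ (π N) N (p N) ≤ A * √(π N * Real.log (p N) / N) := by
  obtain ⟨K, hK, hb⟩ := hO.exists_pos
  refine ⟨2 * C₅ + C₆ * (2 * (K + 1)), by positivity, ?_⟩
  filter_upwards [hb.bound, hp.eventually_ge_atTop 2, eventually_ge_atTop 2] with N h1 h2 h3
  have hN2 : (2 : ℝ) ≤ N := by exact_mod_cast h3
  have hN : (0 : ℝ) < N := by linarith
  have hπN := hπ N
  have hp1 : (1 : ℝ) ≤ p N := by exact_mod_cast (by omega : 1 ≤ p N)
  have hlogp : 0 ≤ Real.log (p N) := Real.log_nonneg hp1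
  have hlogN : 0 ≤ Real.log N := Real.log_nonneg (by linarith)
  rw [Real.norm_of_nonneg (by positivity), Real.norm_of_nonneg (by positivity)] at h1
  have h4 := log_add_one_le_two_mul_log h2
  have hL0 : 0 ≤ Real.log ((p N : ℝ) + 1) := Real.log_nonneg (by linarith)
  have hlog2N : Real.log (2 * N) ≤ 2 * Real.log N := by
    rw [Real.log_mul (by norm_num) hN.ne', two_mul]
    have := Real.log_le_log (by norm_num) hN2
    linarith
  have hlog2N0 : 0 ≤ Real.log (2 * N) := Real.log_nonneg (by linarith)
  set q := √(π N * Real.log (p N) / N) with hq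
  have hq0 : 0 ≤ q := Real.sqrt_nonneg _
  have hqsq : q ^ 2 = π N * Real.log (p N) / N := Real.sq_sqrt (by positivity)
  have e1 : √(π N * Real.log ((p N : ℝ) + 1) / N) ≤ 2 * q := by
    refine Real.sqrt_le_iff.2 ⟨by positivity, ?_⟩
    rw [mul_pow, hqsq, ← mul_div_assoc]
    refine div_le_div_of_nonneg_right ?_ hN.le
    nlinarith [mul_le_mul_of_nonneg_left h4 hπN.le, mul_nonneg hπN.le hlogp]
  have e2 : √(Real.log (2 * N)) * Real.log ((p N : ℝ) + 1) / N ≤ 2 * (K + 1) * q := by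
    refine abs_le_of_sq_le_sq' ?_ (by positivity) |>.2
    rw [div_pow, mul_pow, Real.sq_sqrt hlog2N0, mul_pow _ q, hqsq, div_le_iff₀ (by positivity)]
    have e3 : (2 * (K + 1)) ^ 2 * (π N * Real.log (p N) / N) * (N : ℝ) ^ 2
        = 4 * (K + 1) ^ 2 * (N * π N) * Real.log (p N) := by
      field_simp
      ring
    rw [e3]
    calc Real.log (2 * N) * Real.log ((p N : ℝ) + 1) ^ 2
        ≤ 2 * Real.log N * (2 * Real.log (p N)) ^ 2 := by gcongr
      _ = 8 * (Real.log (p N) * Real.log N) * Real.log (p N) := by ring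
      _ ≤ 8 * (K * (N * π N)) * Real.log (p N) := by gcongr
      _ ≤ 4 * (K + 1) ^ 2 * (N * π N) * Real.log (p N) := by
          refine mul_le_mul_of_nonneg_right ?_ hlogp
          have : 0 ≤ N * π N := by positivity
          nlinarith [sq_nonneg K]
  unfold gradBound
  have e4 := mul_le_mul_of_nonneg_left e1 h5.le
  have e5 := mul_le_mul_of_nonneg_left e2 h6.le
  linarith

theorem eventually_mul_sqrt_le_div (hp : Tendsto p atTop atTop) (hπ : ∀ N, 0 < π N)
    (hs : ∀ N, 0 < s N)
    (hlo : (fun N => (s N : ℝ) * Real.log (p N)) =o[atTop] (fun N => N * π N))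
    {A κ : ℝ} (hA : 0 < A) (hκ : 0 < κ) :
    ∀ᶠ N : ℕ in atTop, A * √(π N * Real.log (p N) / N) ≤ κ * π N / (9 * √(s N)) := by
  have h := hlo.def (show 0 < (κ / (9 * A)) ^ 2 by positivity)
  filter_upwards [h, hp.eventually_ge_atTop 2, eventually_gt_atTop 0] with N h1 h2 h3
  have hN : (0 : ℝ) < N := by exact_mod_cast h3
  have hπN := hπ N
  have hs0 : (0 : ℝ) < s N := by exact_mod_cast hs N
  have hp1 : (1 : ℝ) ≤ p N := by exact_mod_cast (by omega : 1 ≤ p N)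
  have hlog : 0 ≤ Real.log (p N) := Real.log_nonneg hp1
  rw [Real.norm_of_nonneg (by positivity), Real.norm_of_nonneg (by positivity)] at h1
  rw [le_div_iff₀ (by positivity)]
  have h4 : √(π N * Real.log (p N) / N) * √(s N) ≤ κ / (9 * A) * π N := by
    rw [← Real.sqrt_mul (by positivity)]
    refine Real.sqrt_le_iff.2 ⟨by positivity, ?_⟩
    rw [div_mul_eq_mul_div, div_le_iff₀ hN, mul_pow]
    nlinarith
  have h5 := mul_le_mul_of_nonneg_left h4 (show 0 ≤ 9 * A by positivity)
  have h6 : 9 * A * (κ / (9 * A) * π N) = κ * π N := by field_simp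
  linarith

end Rates

/-! ### Asymptotics -/

section Asymptotic

variable {p : ℕ → ℕ} {Ω : ℕ → Type*} [∀ N, MeasurableSpace (Ω N)] {P : ∀ N, Measure (Ω N)}
  [∀ N, IsProbabilityMeasure (P N)] {Q : ∀ N, Measure (Obs (p N))} {γ₀ : ∀ N, Vec (p N + 1)}
  {Z : ∀ N, Fin N → Ω N → Obs (p N)} {κ σ σγ : ℝ} {α : ℕ → ℝ}

theorem sameOrder_eLpNorm'_inv_truePS (hσγ : 0 < σγ)
    (hM : ∀ N, IsOffsetModel (Q N) (γ₀ N))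
    (hlin : ∀ N, psi2Norm (covLaw (Q N)) (linPred (γ₀ N)) ≤ ENNReal.ofReal σγ)
    {r : ℝ} (hr : 0 < r) :
    SameOrder (fun N => (eLpNorm' (fun x => (truePS (Q N) (γ₀ N) x)⁻¹) r (covLaw (Q N))).toReal)
      (fun N => (labelProb (Q N))⁻¹) := by
  set K := 2 * Real.exp (r ^ 2 * σγ ^ 2) with hK
  have hKpos : 0 < K := by positivity
  -- An extra factor `2` on each side makes the inequalities strict.
  refine ⟨K⁻¹ ^ (1 / r) / 2, by positivity, 4 * K ^ (1 / r), by positivity, 0, fun N _ => ?_⟩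
  have hπ : 0 < (labelProb (Q N))⁻¹ := inv_pos.2 (hM N).labelProb_pos
  have hup := (hM N).eLpNorm'_inv_truePS_le hσγ (hlin N) hr
  have hlo := (hM N).le_eLpNorm'_inv_truePS hσγ (hlin N) hr
  have hne := (hup.trans_lt ENNReal.ofReal_lt_top).ne
  rw [ENNReal.ofReal_le_iff_le_toReal hne, ← hK] at hlo
  have hup' := ENNReal.toReal_le_of_le_ofReal (by positivity) hup
  rw [← hK] at hup'
  have h1 : 0 < (labelProb (Q N))⁻¹ * K⁻¹ ^ (1 / r) := by positivity
  have h2 : 0 < (labelProb (Q N))⁻¹ * K ^ (1 / r) := by positivity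
  constructor
  · refine lt_of_lt_of_le ?_ hlo
    linarith
  · refine lt_of_le_of_lt hup' ?_
    linarith

theorem sameOrder_effRate (hσγ : 0 < σγ) (hM : ∀ N, IsOffsetModel (Q N) (γ₀ N))
    (hlin : ∀ N, psi2Norm (covLaw (Q N)) (linPred (γ₀ N)) ≤ ENNReal.ofReal σγ) :
    SameOrder (fun N => effRate (Q N) (γ₀ N)) (fun N => labelProb (Q N)) := by
  refine ⟨(4 * Real.exp (σγ ^ 2))⁻¹ / 2, by positivity, 4 * Real.exp (σγ ^ 2), by positivity, 0,
    fun N _ => ?_⟩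
  have hπ := (hM N).labelProb_pos
  obtain ⟨h1, h2⟩ := (hM N).effRate_mem hσγ (hlin N)
  have h3 : 0 < (4 * Real.exp (σγ ^ 2))⁻¹ * labelProb (Q N) := by positivity
  have h4 : 0 < Real.exp (σγ ^ 2) * labelProb (Q N) := by positivity
  constructor
  · refine lt_of_lt_of_le ?_ h1
    linarith
  · refine lt_of_le_of_lt h2 ?_
    linarith

theorem exists_penalty (hM : ∀ N, IsOffsetModel (Q N) (γ₀ N))
    (hp : Tendsto p atTop atTop)
    (hO : (fun N : ℕ => Real.log (p N) * Real.log N) =O[atTop] (fun N => N * labelProb (Q N)))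
    (hlo : (fun N => (sparsity (γ₀ N) : ℝ) * Real.log (p N)) =o[atTop]
      (fun N => N * labelProb (Q N))) (hκ : 0 < κ) {C₅ C₆ : ℝ} (h5 : 0 < C₅) (h6 : 0 < C₆)
    {c : ℝ} (hc : 0 < c) :
    ∃ A > 0, ∃ lam : ℕ → ℝ, (∀ N, 0 < lam N) ∧
      SameOrder lam (fun N => √(labelProb (Q N) * Real.log (p N) / N)) ∧
      (∀ᶠ N in atTop, lam N = A * √(labelProb (Q N) * Real.log (p N) / N)) ∧
      ∀ᶠ N in atTop,
        2 * (1 + c) * gradBound C₅ C₆ (labelProb (Q N)) N (p N) ≤ lam N ∧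
        lam N ≤ κ * labelProb (Q N) / (9 * √(sparsity (γ₀ N))) ∧
        9 * c * Real.log (p N + 1) < N * labelProb (Q N) := by
  have hπ : ∀ N, 0 < labelProb (Q N) := fun N => (hM N).labelProb_pos
  have hs : ∀ N, 0 < sparsity (γ₀ N) := fun N => (hM N).sparsity_pos
  obtain ⟨A₀, hA₀, hgrad⟩ := exists_eventually_gradBound_le hp hπ hO h5 h6
  set A := 2 * (1 + c) * A₀ with hA
  have hApos : 0 < A := by positivity
  set q : ℕ → ℝ := fun N => √(labelProb (Q N) * Real.log (p N) / N) with hq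
  have hqpos : ∀ᶠ N in atTop, 0 < q N := by
    filter_upwards [hp.eventually_ge_atTop 2, eventually_gt_atTop 0] with N h1 h2
    have hN : (0 : ℝ) < N := by exact_mod_cast h2
    have hlog : 0 < Real.log (p N) := Real.log_pos (by exact_mod_cast (by omega : 1 < p N))
    have := hπ N
    exact Real.sqrt_pos.2 (by positivity)
  have hlam : ∀ᶠ N in atTop, (if 0 < q N then A * q N else 1) = A * q N := by
    filter_upwards [hqpos] with N h
    rw [if_pos h]
  -- For finitely many `N` the root may vanish (`N = 0` or `log p = 0`); the value `1` keeps the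
  -- penalty positive there.
  refine ⟨A, hApos, fun N => if 0 < q N then A * q N else 1, fun N => ?_, ?_, hlam, ?_⟩
  · dsimp only
    split_ifs with h
    · positivity
    · exact one_pos
  · obtain ⟨N₀, hN₀⟩ := eventually_atTop.1 hqpos
    refine ⟨A / 2, by positivity, 2 * A, by positivity, N₀, fun N hN => ?_⟩
    have h := hN₀ N hN.le
    have := mul_pos hApos h
    simp only [if_pos h]
    constructor <;> linarith
  · filter_upwards [hlam, hgrad, eventually_mul_sqrt_le_div hp hπ hs hlo hApos hκ,
      eventually_mul_log_add_one_lt hp hπ hs hlo (9 * c) (by positivity)] with N h1 h2 h3 h4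
    rw [h1]
    refine ⟨?_, h3, h4⟩
    rw [hA, mul_assoc _ A₀]
    exact mul_le_mul_of_nonneg_left h2 (by positivity)

theorem exists_error_event (hσ : 0 < σ) (hσγ : 0 < σγ) (hκ : 0 < κ)
    (hM : ∀ N, IsOffsetModel (Q N) (γ₀ N)) (hZ : ∀ N, IsIIDSample (P N) (Z N) (Q N))
    (hlin : ∀ N, psi2Norm (covLaw (Q N)) (linPred (γ₀ N)) ≤ ENNReal.ofReal σγ)
    (hcov : ∀ N, ∀ j : Fin (p N + 1),
      psi2Norm (covLaw (Q N)) (fun x => augment x j) ≤ ENNReal.ofReal σ)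
    (hrsc : ∀ N, (P N).real
      {ω | ¬ RSC (fun i => Z N i ω) 1 (γ₀ N) κ (coneBall (support (γ₀ N)))} ≤ α N)
    (hp : Tendsto p atTop atTop) (hα : Tendsto α atTop (𝓝 0)) {c A : ℝ} (hc : 0 < c) (hA : 0 < A)
    {lam : ℕ → ℝ} (hlamA : ∀ᶠ N in atTop, lam N = A * √(labelProb (Q N) * Real.log (p N) / N))
    (hlam : ∀ᶠ N in atTop,
      2 * (1 + c) * gradBound (9 * momentBound σ σγ) 14 (labelProb (Q N)) N (p N) ≤ lam N ∧
      lam N ≤ κ * labelProb (Q N) / (9 * √(sparsity (γ₀ N))) ∧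
      9 * c * Real.log (p N + 1) < N * labelProb (Q N)) :
    ∃ C > 0, ∃ B : ∀ N, Set (Ω N), Tendsto (fun N => P N (B N)) atTop (𝓝 0) ∧
      ∀ᶠ N in atTop, ∀ ω ∉ B N, labelProb (Q N) / 2 ≤ labelFreq (fun i => Z N i ω) ∧
        ∀ γhat, IsL1Estimator (fun i => Z N i ω) (lam N) γhat → ‖γhat - γ₀ N‖ ≤ 1 ∧
          2 * |labelFreq (fun i => Z N i ω) - labelProb (Q N)| / labelProb (Q N)
            + 2 * ‖γhat - γ₀ N‖
          ≤ C * √(sparsity (γ₀ N) * Real.log (p N) / (N * labelProb (Q N))) := by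
  -- Quantifying over all minimizers inside the event makes it valid for any selection, measurable
  -- or not.
  set G : ∀ N, Ω N → Prop := fun N ω =>
    labelProb (Q N) / 2 ≤ labelFreq (fun i => Z N i ω) ∧
    |labelFreq (fun i => Z N i ω) - labelProb (Q N)|
      ≤ 14 * √(labelProb (Q N) * (c * Real.log (p N + 1)) / N) ∧
    ∀ γhat, IsL1Estimator (fun i => Z N i ω) (lam N) γhat →
      ‖γhat - γ₀ N‖ ≤ 9 * lam N * √(sparsity (γ₀ N)) / (labelProb (Q N) * κ) with hG
  refine ⟨28 * (1 + c) + 18 * A / κ, by positivity, fun N => {ω | ¬ G N ω}, ?_, ?_⟩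
  -- `14 = 6 + 8`: the good event and the finite-sample bound are combined by a plain union.
  · have hrate : Tendsto (fun N => 14 * ((p N : ℝ) + 1) ^ (-c) + α N) atTop (𝓝 0) := by
      have h1 : Tendsto (fun N => (p N : ℝ) + 1) atTop atTop :=
        tendsto_atTop_add_const_right _ _ (tendsto_natCast_atTop_atTop.comp hp)
      have h2 := ((tendsto_rpow_neg_atTop hc).comp h1).const_mul 14
      simpa using h2.add hα
    have hreal : Tendsto (fun N => (P N).real {ω | ¬ G N ω}) atTop (𝓝 0) := by
      refine squeeze_zero' (Eventually.of_forall fun N => measureReal_nonneg) ?_ hrate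
      filter_upwards [hlam, hp.eventually_gt_atTop 0] with N h1 h2
      obtain ⟨h3, h4, h5⟩ := h1
      obtain ⟨B, hB, hgood⟩ := exists_good_event (hM N) (hZ N) hσ hσγ (hlin N) (hcov N) h2 hc h5
      have hbad := measure_norm_sub_gt_le (hM N) (hZ N) hσ hσγ (hlin N) (hcov N) hκ (hrsc N) hc
        h3 h4 h5
      refine (measureReal_mono (s₂ := B ∪ _) ?_).trans
        ((measureReal_union_le _ _).trans ((add_le_add hB hbad).trans_eq (by ring)))
      intro ω hω
      by_contra hcon
      simp only [Set.mem_union, not_or, Set.mem_ofPred_eq, not_exists, not_and, not_lt] at hcon hω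
      obtain ⟨g1, -, g3, -⟩ := hgood ω hcon.1
      exact hω ⟨g1, g3, hcon.2⟩
    have hlim := ENNReal.tendsto_ofReal hreal
    rw [ENNReal.ofReal_zero] at hlim
    exact hlim.congr fun N => ofReal_measureReal (measure_ne_top _ _)
  · filter_upwards [hlam, hlamA, hp.eventually_ge_atTop 2, eventually_gt_atTop 0]
      with N h1 h2 h3 h4 ω hω
    obtain ⟨-, h5, -⟩ := h1
    simp only [not_not] at hω
    obtain ⟨g1, g2, g3⟩ := hω
    refine ⟨g1, fun γhat hγ => ?_⟩
    have g4 := g3 γhat hγ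
    have hN : (0 : ℝ) < N := by exact_mod_cast h4
    have hπ := (hM N).labelProb_pos
    have hs1 : (1 : ℝ) ≤ sparsity (γ₀ N) := by exact_mod_cast (hM N).sparsity_pos
    have hs : 0 < √(sparsity (γ₀ N) : ℝ) := Real.sqrt_pos.2 (by linarith)
    have hlog : 0 ≤ Real.log (p N) :=
      Real.log_nonneg (by exact_mod_cast (by omega : 1 ≤ p N))
    have hlog1 := log_add_one_le_two_mul_log h3
    set ρ := √(sparsity (γ₀ N) * Real.log (p N) / (N * labelProb (Q N))) with hρ
    have hρ0 : 0 ≤ ρ := Real.sqrt_nonneg _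
    have hρsq : ρ ^ 2 = sparsity (γ₀ N) * Real.log (p N) / (N * labelProb (Q N)) :=
      Real.sq_sqrt (by positivity)
    have e1 : √(labelProb (Q N) * Real.log (p N) / N) * √(sparsity (γ₀ N) : ℝ)
        = labelProb (Q N) * ρ := by
      rw [← Real.sqrt_mul (by positivity),
        show labelProb (Q N) * Real.log (p N) / N * sparsity (γ₀ N)
          = (labelProb (Q N) * ρ) ^ 2 by rw [mul_pow, hρsq]; field_simp]
      exact Real.sqrt_sq (by positivity)
    have e2 : √(labelProb (Q N) * (c * Real.log (p N + 1)) / N)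
        ≤ (1 + c) * (labelProb (Q N) * ρ) := by
      refine Real.sqrt_le_iff.2 ⟨by positivity, ?_⟩
      have e3 : ((1 + c) * (labelProb (Q N) * ρ)) ^ 2
          = (1 + c) ^ 2 * (labelProb (Q N) * Real.log (p N) / N) * sparsity (γ₀ N) := by
        rw [mul_pow, mul_pow, hρsq]; field_simp
      rw [e3]
      have e4 : 0 ≤ labelProb (Q N) * Real.log (p N) / N := by positivity
      calc labelProb (Q N) * (c * Real.log (p N + 1)) / N
          ≤ labelProb (Q N) * (c * (2 * Real.log (p N))) / N := by gcongr
        _ = 2 * c * (labelProb (Q N) * Real.log (p N) / N) := by ring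
        _ ≤ (1 + c) ^ 2 * (labelProb (Q N) * Real.log (p N) / N) := by
            refine mul_le_mul_of_nonneg_right ?_ e4
            nlinarith
        _ ≤ _ := le_mul_of_one_le_right (by positivity) hs1
    constructor
    · refine g4.trans ?_
      rw [le_div_iff₀ (by positivity)] at h5
      rw [div_le_one (by positivity)]
      linarith
    · have e5 : 9 * lam N * √(sparsity (γ₀ N)) / (labelProb (Q N) * κ) = 9 * A / κ * ρ := by
        rw [h2, show 9 * (A * √(labelProb (Q N) * Real.log (p N) / N)) * √(sparsity (γ₀ N) : ℝ)
          = 9 * A * (√(labelProb (Q N) * Real.log (p N) / N) * √(sparsity (γ₀ N) : ℝ)) by ring, e1]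
        field_simp
      rw [e5] at g4
      have e6 : 2 * |labelFreq (fun i => Z N i ω) - labelProb (Q N)| / labelProb (Q N)
          ≤ 28 * (1 + c) * ρ := by
        rw [div_le_iff₀ hπ]
        linarith
      have e7 : (28 * (1 + c) + 18 * A / κ) * ρ = 28 * (1 + c) * ρ + 2 * (9 * A / κ * ρ) := by ring
      rw [e7]
      linarith

end Asymptotic

end OffsetLogit

/-! ### Assembly of the finite-sample and asymptotic statements. -/

theorem mainTheorem4 (σ σγ : ℝ) (hσ : 0 < σ) (hσγ : 0 < σγ) :
    ∃ C₅ > 0, ∃ C₆ > 0, ∀ (p : ℕ → ℕ)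
      (Ω : ℕ → Type*) [∀ N, MeasurableSpace (Ω N)]
      (P : ∀ N, Measure (Ω N)) [∀ N, IsProbabilityMeasure (P N)]
      (Q : ∀ N, Measure (Obs (p N))) (γ₀ : ∀ N, Vec (p N + 1))
      (Z : ∀ N, Fin N → Ω N → Obs (p N)) (κ : ℝ) (α : ℕ → ℝ),
      0 < κ →
      (∀ N, IsOffsetModel (Q N) (γ₀ N)) →
      (∀ N, IsIIDSample (P N) (Z N) (Q N)) →
      -- sub-Gaussian linear predictor and marginally sub-Gaussian covariates
      (∀ N, psi2Norm (covLaw (Q N)) (linPred (γ₀ N)) ≤ ENNReal.ofReal σγ) →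
      (∀ N, ∀ j : Fin (p N + 1),
        psi2Norm (covLaw (Q N)) (fun x => augment x j) ≤ ENNReal.ofReal σ) →
      -- RSC of the balanced logistic loss, except with probability at most `α N`
      (∀ N, (P N).real
        {ω | ¬ RSC (fun i => Z N i ω) 1 (γ₀ N) κ (coneBall (support (γ₀ N)))} ≤ α N) →
      -- finite-sample bound, for every minimizer
      (∀ (N : ℕ) (c lam : ℝ), 0 < c →
        2 * (1 + c) * gradBound C₅ C₆ (labelProb (Q N)) N (p N) ≤ lam →
        lam ≤ κ * labelProb (Q N) / (9 * √(sparsity (γ₀ N))) →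
        9 * c * Real.log (p N + 1) < N * labelProb (Q N) →
        (P N).real {ω | ∃ γhat, IsL1Estimator (fun i => Z N i ω) lam γhat ∧
            9 * lam * √(sparsity (γ₀ N)) / (labelProb (Q N) * κ) < ‖γhat - γ₀ N‖}
          ≤ 8 * ((p N : ℝ) + 1) ^ (-c) + α N) ∧
      -- asymptotic results
      (Tendsto p atTop atTop → Tendsto α atTop (𝓝 0) →
        (fun N => Real.log (p N) * Real.log N) =O[atTop] (fun N => N * labelProb (Q N)) →
        (fun N => sparsity (γ₀ N) * Real.log (p N)) =o[atTop]
          (fun N => N * labelProb (Q N)) →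
        -- joint sub-Gaussianity
        (∀ N, ∀ v : Vec (p N + 1),
          psi2Norm (covLaw (Q N)) (linPred v) ≤ ENNReal.ofReal (σ * ‖v‖)) →
        (∀ r : ℝ, 0 < r → SameOrder
          (fun N => (eLpNorm' (fun x => (truePS (Q N) (γ₀ N) x)⁻¹) r (covLaw (Q N))).toReal)
          (fun N => (labelProb (Q N))⁻¹)) ∧
        SameOrder (fun N => effRate (Q N) (γ₀ N)) (fun N => labelProb (Q N)) ∧
        (∀ c : ℝ, 0 < c → ∃ lam : ℕ → ℝ,
          (∀ N, 0 < lam N) ∧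
          SameOrder lam (fun N => √(labelProb (Q N) * Real.log (p N) / N)) ∧
          -- the finite-sample bound applies to this choice for all large `N`
          (∀ᶠ N in atTop,
            2 * (1 + c) * gradBound C₅ C₆ (labelProb (Q N)) N (p N) ≤ lam N ∧
            lam N ≤ κ * labelProb (Q N) / (9 * √(sparsity (γ₀ N))) ∧
            9 * c * Real.log (p N + 1) < N * labelProb (Q N)) ∧
          ∀ γhat : ∀ N, Ω N → Vec (p N + 1),
            (∀ N ω, IsL1Estimator (fun i => Z N i ω) (lam N) (γhat N ω)) →
            (∀ r : ℝ, 0 < r → IsBigOP P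
              (fun N ω => eLpNorm' (fun x => 1 - truePS (Q N) (γ₀ N) x /
                estPS (fun i => Z N i ω) (γhat N ω) x) r (covLaw (Q N)))
              (fun N => √(sparsity (γ₀ N) * Real.log (p N) / (N * labelProb (Q N))))) ∧
            IsBigOP P
              (fun N ω => weightedMSE (Q N) (γ₀ N) (fun x => 1 - truePS (Q N) (γ₀ N) x /
                estPS (fun i => Z N i ω) (γhat N ω) x))
              (fun N => sparsity (γ₀ N) * Real.log (p N) / (N * labelProb (Q N))) ∧
            IsLittleOPOne P
              (fun N ω => weightedMSE (Q N) (γ₀ N) (fun x => 1 - truePS (Q N) (γ₀ N) x /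
                estPS (fun i => Z N i ω) (γhat N ω) x))) ∧
        -- outcome model
        (∀ (m : ∀ N, Vec (p N) → ℝ) (mhat : ∀ N, Ω N → Vec (p N) → ℝ) (c₂ : ℝ), 0 < c₂ →
          (∀ N, IsRegression (Q N) (m N)) →
          (∀ N ω, Measurable (mhat N ω)) →
          IsLittleOPOne P
            (fun N ω => eLpNorm' (fun x => mhat N ω x - m N x) (2 + c₂) (covLaw (Q N))) →
          IsLittleOPOne P
            (fun N ω => weightedMSE (Q N) (γ₀ N) (fun x => mhat N ω x - m N x)))) := by
  have hK := two_le_momentBound σ σγ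
  refine ⟨9 * momentBound σ σγ, by positivity, 14, by norm_num, ?_⟩
  intro p Ω _ P _ Q γ₀ Z κ α hκ hM hZ hlin hcov hrsc
  refine ⟨fun N c lam hc h1 h2 h3 =>
    measure_norm_sub_gt_le (hM N) (hZ N) hσ hσγ (hlin N) (hcov N) hκ (hrsc N) hc h1 h2 h3, ?_⟩
  intro hp hα hO hlo hsub
  have hwmse : ∀ r : ℝ, 2 < r → ∃ K > 0, ∀ (N : ℕ) (h : Vec (p N) → ℝ), Measurable h →
      weightedMSE (Q N) (γ₀ N) h
        ≤ ENNReal.ofReal K * eLpNorm' h r (covLaw (Q N)) ^ (2 : ℝ) := by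
    intro r hr
    have hqr := (Real.HolderConjugate.conjExponent (show 1 < r / 2 by linarith)).symm
    exact ⟨_, by positivity, fun N h hh =>
      (hM N).weightedMSE_le hσγ (hlin N) (by linarith) hqr hh⟩
  refine ⟨fun r hr => sameOrder_eLpNorm'_inv_truePS hσγ hM hlin hr,
    sameOrder_effRate hσγ hM hlin, ?_, ?_⟩
  · intro c hc
    obtain ⟨A, hA, lam, hpos, hsame, hlamA, hlam⟩ := exists_penalty hM hp hO hlo hκ
      (show 0 < 9 * momentBound σ σγ by positivity) (show (0 : ℝ) < 14 by norm_num) hc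
    refine ⟨lam, hpos, hsame, hlam, fun γhat hγ => ?_⟩
    obtain ⟨C, hC, B, hB, hgood⟩ := exists_error_event hσ hσγ hκ hM hZ hlin hcov hrsc hp hα hc hA
      hlamA hlam
    have herr : ∀ r : ℝ, 0 < r → ∃ M > 0, ∀ᶠ N in atTop, ∀ ω ∉ B N,
        eLpNorm' (fun x => 1 - truePS (Q N) (γ₀ N) x /
          estPS (fun i => Z N i ω) (γhat N ω) x) r (covLaw (Q N))
        ≤ ENNReal.ofReal (M * √(sparsity (γ₀ N) * Real.log (p N) / (N * labelProb (Q N)))) := by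
      intro r hr
      refine ⟨C * (2 * Real.exp ((r * 2) ^ 2 * σ ^ 2)) ^ (1 / r), by positivity, ?_⟩
      filter_upwards [hgood] with N hN ω hω
      obtain ⟨h1, h2⟩ := hN ω hω
      obtain ⟨h3, h4⟩ := h2 _ (hγ N ω)
      refine ((hM N).eLpNorm'_one_sub_truePS_div_le hσ (hsub N) h1 h3 hr).trans
        (ENNReal.ofReal_le_ofReal ?_)
      rw [mul_right_comm]
      exact mul_le_mul_of_nonneg_right h4 (by positivity)
    have hmse : ∃ M > 0, ∀ᶠ N in atTop, ∀ ω ∉ B N,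
        weightedMSE (Q N) (γ₀ N) (fun x => 1 - truePS (Q N) (γ₀ N) x /
          estPS (fun i => Z N i ω) (γhat N ω) x)
        ≤ ENNReal.ofReal (M * (sparsity (γ₀ N) * Real.log (p N) / (N * labelProb (Q N)))) := by
      -- Any exponent above `2` would do, since the ratio error has the same rate in every `L^r`.
      obtain ⟨K, hKpos, hw⟩ := hwmse 4 (by norm_num)
      obtain ⟨M, hMpos, hle⟩ := herr 4 (by norm_num)
      refine ⟨K * M ^ 2, by positivity, ?_⟩
      filter_upwards [hle] with N hN ω hω
      have hπ := (hM N).labelProb_pos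
      refine (hw N _ (by unfold truePS estPS; fun_prop)).trans ?_
      refine (mul_le_mul_right (ENNReal.rpow_le_rpow (hN ω hω) (by norm_num)) _).trans_eq ?_
      rw [ENNReal.ofReal_rpow_of_nonneg (by positivity) (by norm_num), Real.rpow_two,
        ← ENNReal.ofReal_mul hKpos.le, mul_pow, Real.sq_sqrt, ← mul_assoc]
      exact div_nonneg (mul_nonneg (Nat.cast_nonneg _) (Real.log_natCast_nonneg _))
        (mul_nonneg (Nat.cast_nonneg _) hπ.le)
    refine ⟨fun r hr => ?_, ?_, ?_⟩
    · obtain ⟨M, hMpos, hle⟩ := herr r hr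
      exact IsBigOP.of_eventually_le hB hMpos hle
    · obtain ⟨M, hMpos, hle⟩ := hmse
      exact IsBigOP.of_eventually_le hB hMpos hle
    · obtain ⟨M, hMpos, hle⟩ := hmse
      exact IsLittleOPOne.of_eventually_le hB
        (by simpa using hlo.tendsto_div_nhds_zero.const_mul M) hle
  · intro m mhat c₂ hc₂ hm hmhat herr
    obtain ⟨K, hKpos, hw⟩ := hwmse (2 + c₂) (by linarith)
    exact herr.of_le_mul_rpow_two hKpos fun N ω => hw N _ ((hmhat N ω).sub (hm N).1)
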